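/- Notation. Let $n\ge 1$, let $\mathbb D^n(0,\rho)=\{z\in\mathbb C^n:|z_l|<\rho,\ l=1,\dots,n\}$ and $\mathbb D^n=\mathbb D^n(0,1)$. For $\alpha\in\mathbb N^n$ put $|\alpha|=\alpha_1+\dots+\alpha_n$ and $z^\alpha=z_1^{\alpha_1}\cdots z_n^{\alpha_n}$. Let $\alpha(0)=0,\alpha(1),\alpha(2),\dots$ be the enumeration of $\mathbb N^n$ in graded lexicographic order: $\alpha(k_1)$ precedes $\alpha(k_2)$ if $|\alpha(k_1)|<|\alpha(k_2)|$, or if $|\alpha(k_1)|=|\alpha(k_2)|$ and $\alpha_j(k_1)>\alpha_j(k_2)$ for the smallest $j$ with $\alpha_j(k_1)\ne\alpha_j(k_2)$. Put $\widehat e_k(w)=w^{\alpha(k)}$. For a vector field $G$ holomorphic near $0$ put $L_Gf=G\cdot\nabla f$, and for $f,g$ holomorphic near $0$ with Taylor coefficients $f_\beta,g_\beta$ at $0$ put $\langle f,g\rangle=\sum_\beta f_\beta\overline{g_\beta}$ whenever this converges (the inner product of the Hardy space $\mathbb H^2(\mathbb D^n)$); thus $\langle L_G\widehat e_k,\widehat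 e_j\rangle$ is the coefficient of $w^{\alpha(j)}$ in $L_G\widehat e_k$. Theorem. Let $\{\dot z=F^{(i)}(z)\}_{i=1}^m$ be a switched system with $F^{(i)}:\mathbb D^n\to\mathbb C^n$ holomorphic, such that each $F^{(i)}$ generates a forward flow $\varphi_i^t:\mathbb D^n\to\mathbb D^n$, $t\ge0$. Assume that - for every $i$, $F^{(i)}(0)=0$, all eigenvalues of the Jacobian matrix $JF^{(i)}(0)$ have negative real part, and $0$ is globally asymptotically stable on $\mathbb D^n$ for $\varphi_i^t$ (that is, Lyapunov stable and attracting every point of $\mathbb D^n$); - the complex Lie algebra of matrices generated by $JF^{(1)}(0),\dots,JF^{(m)}(0)$ is solvable; - $\rho\in(0,1]$ is such that $\varphi_i^t(\mathbb D^n(0,\rho))\subseteq\mathbb D^n(0,\rho)$ for all $i$ and all $t\ge 0$. Then there is an invertible complex matrix $P$ with $\|P^{-1}\|_\infty=1$ (the operator norm induced by the maximum norm) such that all $P^{-1}JF^{(i)}(0)P$ are upper triangular. For every such $P$ the following holds. Put $\widehat F^{(i)}(w)=P^{-1}F^{(i)}(Pw)$. For $i=1,\dots,m$ let $(b^{(i)}_{jk})_{j,k\ge1}$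 be nonnegative real numbers such that $\sum_{k\ge1}b^{(i)}_{jk}\le1$ for all $j\geq 1$, and $b^{(i)}_{jk}b^{(i)}_{kj}>0$ for all $j,k\ge 1$ with $\langle L_{\widehat F^{(i)}}\widehat e_k,\widehat e_j\rangle\ne0$. For $1\le k<j$ define $$Q^{(i)}_{jk}=\frac{|\langle L_{\widehat F^{(i)}}\widehat e_k,\widehat e_j\rangle|^2}{4\,|\Re\langle L_{\widehat F^{(i)}}\widehat e_j,\widehat e_j\rangle|\,|\Re\langle L_{\widehat F^{(i)}}\widehat e_k,\widehat e_k\rangle|}\cdot\frac1{b^{(i)}_{jk}b^{(i)}_{kj}}$$ if $\langle L_{\widehat F^{(i)}}\widehat e_k,\widehat e_j\rangle\ne0$, and $Q^{(i)}_{jk}=0$ otherwise. Let $(\epsilon_j)_{j\ge1}$ be positive real numbers with $$\epsilon_j>\max_{1\le i\le m,\ 1\le k\le j-1}\epsilon_k\,Q^{(i)}_{jk}\qquad(j\ge2),$$ and suppose that $\sum_{k\ge1}|\alpha(k)|\,\epsilon_k\,\rho^{2|\alpha(k)|}$ converges. Then the switched system is globally uniformly asymptotically stable (GUAS) on $\mathbb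 D^n(0,\rho)$. Moreover, the series $$V(z)=\sum_{k=1}^\infty\epsilon_k\left|(P^{-1}z)^{\alpha(k)}\right|^2$$ converges for every $z\in\mathbb D^n(0,\rho)$, and $V$ is a common Lyapunov function on $\mathbb D^n(0,\rho)$: it is $C^1$ in the real sense, $V(0)=0$, and for all $z\in\mathbb D^n(0,\rho)\setminus\{0\}$ one has $V(z)>0$ and $\nabla V\cdot F^{(i)}(z)<0$ for every $i$. Here a commutation law is a piecewise constant function $\sigma:[0,\infty)\to\{1,\dots,m\}$ with finitely many discontinuities in every bounded interval; a trajectory for $\sigma$ is a continuous $x:[0,\infty)\to\mathbb D^n$ with $\dot x(t)=F^{(\sigma(t))}(x(t))$ at every time $t$ at which $\sigma$ is continuous. GUAS on $D$ means: for every $\epsilon>0$ there is $\delta>0$ such that $\|x(0)\|\le\delta$ implies $\|x(t)\|\le\epsilon$ for all $t>0$, for all $\sigma$ and all trajectories $x$ for $\sigma$; there is $\delta>0$ such that $\|x(0)\|\le\delta$ implies $x(t)\to0$ as $t\to\infty$, for all $\sigma$ and all trajectories $x$ for $\sigma$; and $x(0)\in D$ implies $x(t)\to0$ as $t\to\infty$,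 for all $\sigma$ and all trajectories $x$ for $\sigma$. -/

import Mathlib

open scoped Matrix Topology

namespace SwitchedKoopman

/-! ### Multi-indices and the graded lexicographic enumeration of monomials -/

/-- Total degree `|α| = α₁ + ⋯ + αₙ`. -/
def degree {n : ℕ} (α : Fin n → ℕ) : ℕ := ∑ l, α l

/-- The order on monomials: `z^α` precedes `z^β` if `|α| < |β|`, or if `|α| = |β|` and
`α_j > β_j` for the smallest `j` such that `α_j ≠ β_j`. -/
def MonomialLT {n : ℕ} (α β : Fin n → ℕ) : Prop :=
  degree α < degree β ∨
    (degree α = degree β ∧ ∃ j, β j < α j ∧ ∀ i < j, α i = β i)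

/-- A copy of the set of multi-indices, to carry the monomial order. -/
def GradedIndex (n : ℕ) : Type := Fin n → ℕ

/-- The key that turns the monomial order into a lexicographic order. -/
def monomialKey {n : ℕ} (α : Fin n → ℕ) : ℕ ×ₗ Lex (Fin n → ℕᵒᵈ) :=
  toLex (degree α, toLex fun i => OrderDual.toDual (α i))

theorem monomialKey_injective {n : ℕ} : Function.Injective (monomialKey (n := n)) := by
  intro α β h
  funext i
  exact congrFun (congrArg (fun p => ofLex (ofLex p).2) h) i

theorem monomialLT_of_key {n : ℕ} {α β : Fin n → ℕ} (h : monomialKey α < monomialKey β) :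
    MonomialLT α β := by
  rcases (Prod.Lex.toLex_lt_toLex.1 h) with h | ⟨h, j, hj, hlt⟩
  · exact Or.inl h
  · exact Or.inr ⟨h, j, hlt, fun i hi => hj i hi⟩

/-- There is an enumeration `α(0), α(1), …` of all multi-indices which is increasing for the
monomial order (and it is unique, as the order is total). -/
theorem exists_monomialEnum (n : ℕ) [NeZero n] :
    ∃ a : ℕ → (Fin n → ℕ), Function.Bijective a ∧ ∀ k j, k < j → MonomialLT (a k) (a j) := by
  classical
  let key : GradedIndex n → ℕ ×ₗ Lex (Fin n → ℕᵒᵈ) := fun α => monomialKey (n := n) α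
  have hkey : Function.Injective key := monomialKey_injective
  let _ : LinearOrder (GradedIndex n) := LinearOrder.lift' key hkey
  have hle : ∀ α β : GradedIndex n, α ≤ β ↔ key α ≤ key β := fun _ _ => Iff.rfl
  have hlt : ∀ α β : GradedIndex n, α < β ↔ key α < key β := fun _ _ => Iff.rfl
  have hdeg : ∀ α β : GradedIndex n, α ≤ β → degree (n := n) α ≤ degree (n := n) β := by
    intro α β h
    rcases (Prod.Lex.toLex_le_toLex.1 ((hle α β).1 h)) with h | ⟨h, -⟩
    · exact h.le
    · exact h.le
  have hfin : ∀ N : ℕ, {α : Fin n → ℕ | degree α ≤ N}.Finite := by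
    intro N
    refine (Set.Finite.pi' (ι := Fin n) (t := fun _ => {a : ℕ | a ≤ N})
      (fun _ => Set.finite_le_nat N)).subset ?_
    intro α hα i
    exact (Finset.single_le_sum (f := α) (fun _ _ => Nat.zero_le _) (Finset.mem_univ i)).trans hα
  let _ : LocallyFiniteOrder (GradedIndex n) := LocallyFiniteOrder.ofFiniteIcc fun α β =>
    (hfin (degree (n := n) β)).subset fun γ hγ => hdeg _ _ hγ.2
  let _ : OrderBot (GradedIndex n) :=
    { bot := fun _ => (0 : ℕ)
      bot_le := by
        intro α
        by_cases h : degree (n := n) α = 0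
        · have : α = fun _ => (0 : ℕ) := by
            funext i
            exact (Finset.sum_eq_zero_iff.1 h) i (Finset.mem_univ i)
          exact this.ge
        · refine le_of_lt ((hlt _ _).2 (Prod.Lex.toLex_lt_toLex.2 (Or.inl ?_)))
          simpa [degree] using Nat.pos_of_ne_zero h }
  have _ : NoMaxOrder (GradedIndex n) := ⟨fun α => by
    refine ⟨fun i => (α i + 1 : ℕ), (hlt _ _).2 (Prod.Lex.toLex_lt_toLex.2 (Or.inl ?_))⟩
    exact Finset.sum_lt_sum_of_nonempty (s := (Finset.univ : Finset (Fin n)))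
      ⟨0, Finset.mem_univ _⟩ fun i _ => Nat.lt_succ_self (α i)⟩
  let _ : SuccOrder (GradedIndex n) := LinearLocallyFiniteOrder.succOrder _
  let _ : PredOrder (GradedIndex n) := LinearLocallyFiniteOrder.predOrder _
  let e : GradedIndex n ≃o ℕ := orderIsoNatOfLinearSuccPredArch
  exact ⟨e.symm, e.symm.bijective, fun k j h =>
    monomialLT_of_key ((hlt _ _).1 (e.symm.lt_iff_lt.2 h))⟩

/-- The map `k ↦ α(k)`; thus `α(0) = 0` and `α(1), …, α(n)` are the unit multi-indices. -/
noncomputable def monomialEnum (n : ℕ) [NeZero n] : ℕ → (Fin n → ℕ) :=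
  Classical.choose (exists_monomialEnum n)

theorem monomialEnum_bijective (n : ℕ) [NeZero n] : Function.Bijective (monomialEnum n) :=
  (Classical.choose_spec (exists_monomialEnum n)).1

theorem monomialEnum_lt (n : ℕ) [NeZero n] {k j : ℕ} (h : k < j) :
    MonomialLT (monomialEnum n k) (monomialEnum n j) :=
  (Classical.choose_spec (exists_monomialEnum n)).2 k j h

/-- The monomial `z^α`. -/
def monomial {n : ℕ} (α : Fin n → ℕ) (z : Fin n → ℂ) : ℂ := ∏ l, z l ^ α l

/-! ### The polydisk, Taylor coefficients and the Koopman matrix -/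

/-- The open polydisk `𝔻ⁿ(0, ρ)`. -/
def polydisk (n : ℕ) (ρ : ℝ) : Set (Fin n → ℂ) := {z | ∀ l, ‖z l‖ < ρ}

/-- The complex partial derivative `∂f/∂z_l`. -/
noncomputable def partialDeriv {n : ℕ} (l : Fin n) (f : (Fin n → ℂ) → ℂ) : (Fin n → ℂ) → ℂ :=
  fun z => fderiv ℂ f z (Pi.single l 1)

/-- The mixed derivative `∂₁^{β₁} ⋯ ∂ₙ^{βₙ} f`. -/
noncomputable def mixedDeriv {n : ℕ} (β : Fin n → ℕ) (f : (Fin n → ℂ) → ℂ) : (Fin n → ℂ) → ℂ :=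
  (List.finRange n).foldr (fun l g => (partialDeriv l)^[β l] g) f

/-- The coefficient of `z^β` in the Taylor series at `0` of a function holomorphic near `0`. -/
noncomputable def taylorCoeff {n : ℕ} (f : (Fin n → ℂ) → ℂ) (β : Fin n → ℕ) : ℂ :=
  mixedDeriv β f 0 / ((∏ l, (β l).factorial : ℕ) : ℂ)

/-- The inner product `⟨f, g⟩ = ∑_β f_β conj(g_β)` of the Hardy space `H²(𝔻ⁿ)`, for which the
monomials are orthonormal, written in Taylor coefficients at `0`. -/
noncomputable def hardyInner {n : ℕ} (f g : (Fin n → ℂ) → ℂ) : ℂ :=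
  ∑' β : Fin n → ℕ, taylorCoeff f β * (starRingEnd ℂ) (taylorCoeff g β)

/-- The Koopman generator `L_F f = F · ∇f`. -/
noncomputable def koopmanGenerator {n : ℕ} (F : (Fin n → ℂ) → (Fin n → ℂ))
    (f : (Fin n → ℂ) → ℂ) : (Fin n → ℂ) → ℂ :=
  fun z => fderiv ℂ f z (F z)

/-- The entry `⟨L_F e_k, e_j⟩` of the Koopman matrix, with `e_k(z) = z^{α(k)}`. -/
noncomputable def koopmanEntry {n : ℕ} [NeZero n] (F : (Fin n → ℂ) → (Fin n → ℂ)) (k j : ℕ) : ℂ :=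
  hardyInner (koopmanGenerator F (monomial (monomialEnum n k))) (monomial (monomialEnum n j))

/-- The Jacobian matrix `JF(z)`. -/
noncomputable def jacobian {n : ℕ} (F : (Fin n → ℂ) → (Fin n → ℂ)) (z : Fin n → ℂ) :
    Matrix (Fin n) (Fin n) ℂ :=
  LinearMap.toMatrix' (fderiv ℂ F z : (Fin n → ℂ) →ₗ[ℂ] (Fin n → ℂ))

section

attribute [local instance] LieRing.ofAssociativeRing

/-- The complex Lie algebra of matrices generated by the `A⁽ⁱ⁾`, with bracket `[A, B] = AB - BA`, is
solvable. -/
def GeneratesSolvable {n m : ℕ} (A : Fin m → Matrix (Fin n) (Fin n) ℂ) : Prop :=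
  LieAlgebra.IsSolvable (LieSubalgebra.lieSpan ℂ (Matrix (Fin n) (Fin n) ℂ) (Set.range A))

end

open scoped Matrix.Norms.Operator in
/-- The matrix norm `‖A‖_∞` induced by the maximum norm (the maximal absolute row sum). -/
noncomputable def infNorm {n : ℕ} (A : Matrix (Fin n) (Fin n) ℂ) : ℝ := ‖A‖

/-- `P` is invertible, `‖P⁻¹‖_∞ = 1`, and every `P⁻¹ A⁽ⁱ⁾ P` is upper triangular. -/
def IsNormalizedTriangularizer {n m : ℕ} (A : Fin m → Matrix (Fin n) (Fin n) ℂ)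
    (P : Matrix (Fin n) (Fin n) ℂ) : Prop :=
  IsUnit P ∧ infNorm P⁻¹ = 1 ∧ ∀ i, (P⁻¹ * A i * P).BlockTriangular id

/-- The vector field in the coordinates `w = P⁻¹ z`, that is `w ↦ P⁻¹ F(P w)`. -/
noncomputable def conjField {n : ℕ} (P : Matrix (Fin n) (Fin n) ℂ)
    (F : (Fin n → ℂ) → (Fin n → ℂ)) : (Fin n → ℂ) → (Fin n → ℂ) :=
  fun w => P⁻¹ *ᵥ F (P *ᵥ w)

open scoped Classical in
/-- The number `Q_{jk}` built from the Koopman matrix of `F` and the weights `b`. -/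
noncomputable def crossRatio {n : ℕ} [NeZero n] (F : (Fin n → ℂ) → (Fin n → ℂ))
    (b : ℕ → ℕ → ℝ) (j k : ℕ) : ℝ :=
  if koopmanEntry F k j ≠ 0 then
    ‖koopmanEntry F k j‖ ^ 2 / (4 * |(koopmanEntry F j j).re| * |(koopmanEntry F k k).re|)
      * (1 / (b j k * b k j))
  else 0

/-! ### Flows, stability and Lyapunov functions -/

/-- `φ` is the forward flow of `ż = F(z)` on the state space `X`, which it maps into itself. -/
structure IsForwardFlow {n : ℕ} (X : Set (Fin n → ℂ)) (F : (Fin n → ℂ) → (Fin n → ℂ))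
    (φ : ℝ → (Fin n → ℂ) → (Fin n → ℂ)) : Prop where
  zero : ∀ z ∈ X, φ 0 z = z
  mapsTo : ∀ t, 0 ≤ t → Set.MapsTo (φ t) X X
  deriv : ∀ z ∈ X, ∀ t, 0 ≤ t →
    HasDerivWithinAt (fun s => φ s z) (F (φ t z)) (Set.Ici 0) t

/-- The equilibrium `0` is globally asymptotically stable on `X` for the flow `φ`. -/
def IsGASFlow {n : ℕ} (X : Set (Fin n → ℂ)) (φ : ℝ → (Fin n → ℂ) → (Fin n → ℂ)) : Prop :=
  (∀ ε > 0, ∃ δ > 0, ∀ z ∈ X, ‖z‖ ≤ δ → ∀ t, 0 ≤ t → ‖φ t z‖ ≤ ε) ∧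
    ∀ z ∈ X, Filter.Tendsto (fun t => φ t z) Filter.atTop (𝓝 0)

/-- A commutation law on `[0, ∞)`: a function with values in the discrete set `{1, …, m}` that has
finitely many discontinuities in every bounded interval (hence is piecewise constant). -/
def IsCommutationLaw {m : ℕ} (σ : ℝ → Fin m) : Prop :=
  ∀ T : ℝ, {t | 0 ≤ t ∧ t ≤ T ∧ ¬ ContinuousWithinAt σ (Set.Ici 0) t}.Finite

/-- `x` is a trajectory in `X` of the switched system: a continuous curve on `[0, ∞)` which solves
`ẋ(t) = F^{(σ(t))}(x(t))` at all times where `σ` does not switch. -/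
structure IsSwitchedTrajectory {n m : ℕ} (X : Set (Fin n → ℂ))
    (F : Fin m → (Fin n → ℂ) → (Fin n → ℂ)) (σ : ℝ → Fin m) (x : ℝ → (Fin n → ℂ)) : Prop where
  continuousOn : ContinuousOn x (Set.Ici 0)
  mem : ∀ t, 0 ≤ t → x t ∈ X
  deriv : ∀ t, 0 ≤ t → ContinuousWithinAt σ (Set.Ici 0) t →
    HasDerivWithinAt x (F (σ t) (x t)) (Set.Ici 0) t

/-- The equilibrium `0` of the switched system on `X` is uniformly asymptotically stable. -/
def IsUAS {n m : ℕ} (X : Set (Fin n → ℂ)) (F : Fin m → (Fin n → ℂ) → (Fin n → ℂ)) : Prop :=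
  (∀ ε > 0, ∃ δ > 0, ∀ σ : ℝ → Fin m, IsCommutationLaw σ → ∀ x, IsSwitchedTrajectory X F σ x →
    ‖x 0‖ ≤ δ → ∀ t, 0 < t → ‖x t‖ ≤ ε) ∧
  (∃ δ > 0, ∀ σ : ℝ → Fin m, IsCommutationLaw σ → ∀ x, IsSwitchedTrajectory X F σ x →
    ‖x 0‖ ≤ δ → Filter.Tendsto x Filter.atTop (𝓝 0))

/-- The equilibrium `0` of the switched system on `X` is globally uniformly asymptotically stable
on `D ⊆ X`. -/
def IsGUAS {n m : ℕ} (X : Set (Fin n → ℂ)) (F : Fin m → (Fin n → ℂ) → (Fin n → ℂ))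
    (D : Set (Fin n → ℂ)) : Prop :=
  IsUAS X F ∧
    ∀ σ : ℝ → Fin m, IsCommutationLaw σ → ∀ x, IsSwitchedTrajectory X F σ x →
      x 0 ∈ D → Filter.Tendsto x Filter.atTop (𝓝 0)

/-- `V` is a common Lyapunov function on the open set `D` for the family `F` and the equilibrium
`0`; `C¹` and the derivative are meant in the real sense (`ℂⁿ = ℝ²ⁿ`). -/
structure IsCommonLyapunov {n m : ℕ} (F : Fin m → (Fin n → ℂ) → (Fin n → ℂ))
    (D : Set (Fin n → ℂ)) (V : (Fin n → ℂ) → ℝ) : Prop where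
  contDiffOn : ContDiffOn ℝ 1 V D
  zero : V 0 = 0
  pos : ∀ z ∈ D, z ≠ 0 → 0 < V z
  deriv_neg : ∀ i, ∀ z ∈ D, z ≠ 0 → fderiv ℝ V z (F i z) < 0

end SwitchedKoopman

open SwitchedKoopman

/-!
After a linear change of coordinates, provided by Lie's theorem, the linearizations are upper
triangular. In the graded lexicographic order the matrix `⟨L e_k, e_j⟩` of each Koopman generator
is then lower triangular, with diagonal entries `∑ l, α_l J_ll` of negative real part. Weighting
the monomials by `ε` and comparing each off-diagonal entry with the two diagonal entries it couples
(weighted AM-GM, with the weights `b`) makes the quadratic form `2 Re ⟨L f, f⟩` negative, and its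
value at the vector of the `w^{α(k)}` is the derivative of `V` along the vector field.

Since a flow preserves the polydisk `𝔻ⁿ(0, ρ)` and fixes `0`, the Schwarz lemma on complex lines
gives `‖φ^t z‖ ≤ ‖z‖`; it needs that the flow is holomorphic in the initial value. Hence the norm of
a trajectory never increases. A trajectory not tending to `0` stays in a compact subset of
`𝔻ⁿ(0, ρ) \ {0}`, where `V` decreases at a uniform rate, contradicting `V > 0`.
-/

namespace SwitchedKoopman

section Regularity

open Filter Metric MeasureTheory

variable {E G : Type*} [NormedAddCommGroup E] [NormedSpace ℂ E] [NormedAddCommGroup G]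
  [NormedSpace ℂ G] {U : Set E} {f : E → G}

theorem exists_forall_norm_fderiv_le (hU : IsOpen U) (hf : DifferentiableOn ℂ f U) {z : E}
    (hz : z ∈ U) : ∃ r > 0, ball z r ⊆ U ∧ ∃ C, ∀ w ∈ ball z r, ‖fderiv ℂ f w‖ ≤ C := by
  obtain ⟨R, hR, hRU⟩ := Metric.mem_nhds_iff.1 (inter_mem (hU.mem_nhds hz)
    ((hf.continuousOn.continuousAt (hU.mem_nhds hz)).preimage_mem_nhds
      (closedBall_mem_nhds (f z) one_pos)))
  have hsub : ∀ w ∈ ball z (R / 2), ball w (R / 2) ⊆ ball z R := fun w hw =>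
    ball_subset_ball' (by linarith [mem_ball.1 hw])
  refine ⟨R / 2, half_pos hR, fun w hw => (hRU (hsub w hw (mem_ball_self (half_pos hR)))).1,
    2 / (R / 2), fun w hw => Complex.norm_fderiv_le_div_of_mapsTo_ball
      (hf.mono fun y hy => (hRU (hsub w hw hy)).1) (fun y hy => ?_) (half_pos hR)⟩
  have hy1 : dist (f y) (f z) ≤ 1 := (hRU (hsub w hw hy)).2
  have hw1 : dist (f w) (f z) ≤ 1 := (hRU (hsub w hw (mem_ball_self (half_pos hR)))).2
  exact mem_closedBall.2 ((dist_triangle_right _ _ _).trans (by linarith))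

theorem fderiv_apply_eq_circleIntegral [CompleteSpace G] (hU : IsOpen U)
    (hf : DifferentiableOn ℂ f U) {z v : E} {r : ℝ} (hr : 0 < r)
    (hzv : ∀ ζ ∈ closedBall (0 : ℂ) r, z + ζ • v ∈ U) :
    fderiv ℂ f z v =
      (2 * Real.pi * Complex.I : ℂ)⁻¹ • ∮ ζ in C(0, r), (ζ ^ 2)⁻¹ • f (z + ζ • v) := by
  have hU' : IsOpen ((fun ζ : ℂ => z + ζ • v) ⁻¹' U) := hU.preimage (by fun_prop)
  have hderiv : ∀ ζ : ℂ, z + ζ • v ∈ U →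
      HasDerivAt (fun ζ : ℂ => f (z + ζ • v)) (fderiv ℂ f (z + ζ • v) v) ζ := fun ζ hζ =>
    (hf.differentiableAt (hU.mem_nhds hζ)).hasFDerivAt.comp_hasDerivAt ζ
      (by simpa using ((hasDerivAt_id ζ).smul_const v).const_add z)
  have hcauchy := Complex.two_pi_I_inv_smul_circleIntegral_sub_sq_inv_smul_of_differentiable hU'
    (fun ζ hζ => hzv ζ hζ) (fun ζ hζ => (hderiv ζ hζ).differentiableAt.differentiableWithinAt)
    (mem_ball_self hr)
  have hz : z + (0 : ℂ) • v ∈ U := hzv 0 (mem_closedBall_self hr.le)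
  simpa only [sub_zero, (hderiv 0 hz).deriv, zero_smul, add_zero] using hcauchy.symm

variable [FiniteDimensional ℂ E] [FiniteDimensional ℂ G]

theorem differentiableAt_circleIntegral_add_smul {κ : ℂ → ℂ} {s : Set E} {z v : E} {r C : ℝ}
    (hκ : ContinuousOn κ (sphere 0 |r|)) (hs : s ∈ 𝓝 z)
    (hf : ∀ w ∈ s, ∀ ζ ∈ sphere (0 : ℂ) |r|, DifferentiableAt ℂ f (w + ζ • v))
    (hC : ∀ w ∈ s, ∀ ζ ∈ sphere (0 : ℂ) |r|, ‖fderiv ℂ f (w + ζ • v)‖ ≤ C) :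
    DifferentiableAt ℂ (fun w => ∮ ζ in C(0, r), κ ζ • f (w + ζ • v)) z := by
  have := FiniteDimensional.complete ℂ G
  borelize E (E →L[ℂ] G)
  have hmem : ∀ θ, circleMap 0 r θ ∈ sphere (0 : ℂ) |r| := circleMap_mem_sphere' 0 r
  have hker : Continuous fun θ => deriv (circleMap 0 r) θ * κ (circleMap 0 r θ) := by
    refine Continuous.mul ?_ (hκ.comp_continuous (continuous_circleMap 0 r) hmem)
    rw [funext (deriv_circleMap 0 r)]
    fun_prop
  have hintegrand : ∀ w ∈ s, Continuous fun θ =>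
      (deriv (circleMap 0 r) θ * κ (circleMap 0 r θ)) • f (w + circleMap 0 r θ • v) :=
    fun w hw => hker.smul <| continuous_iff_continuousAt.2 fun θ =>
      (hf w hw _ (hmem θ)).continuousAt.comp (f := fun θ => w + circleMap 0 r θ • v)
        (by fun_prop)
  have hderiv := intervalIntegral.hasFDerivAt_integral_of_dominated_of_fderiv_le (𝕜 := ℂ)
    (μ := volume) (a := 0) (b := 2 * Real.pi)
    (F' := fun w θ => (deriv (circleMap 0 r) θ * κ (circleMap 0 r θ)) •
      fderiv ℂ f (w + circleMap 0 r θ • v))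
    (bound := fun θ => ‖deriv (circleMap 0 r) θ * κ (circleMap 0 r θ)‖ * C) hs
    (eventually_of_mem hs fun w hw => (hintegrand w hw).aestronglyMeasurable)
    ((hintegrand z (mem_of_mem_nhds hs)).intervalIntegrable _ _)
    (hker.measurable.smul ((measurable_fderiv ℂ f).comp
      (by fun_prop : Continuous fun θ => z + circleMap 0 r θ • v).measurable)).aestronglyMeasurable
    (.of_forall fun θ _ w hw => by
      rw [norm_smul]; gcongr; exact hC w hw _ (hmem θ))
    ((hker.norm.mul continuous_const).intervalIntegrable _ _)
    (.of_forall fun θ _ w hw => ((hf w hw _ (hmem θ)).hasFDerivAt.comp w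
      ((hasFDerivAt_id w).add_const _)).const_smul _)
  simpa only [circleIntegral, smul_smul] using hderiv.differentiableAt

theorem differentiableOn_fderiv_apply (hU : IsOpen U) (hf : DifferentiableOn ℂ f U) (v : E) :
    DifferentiableOn ℂ (fun z => fderiv ℂ f z v) U := by
  have := FiniteDimensional.complete ℂ G
  intro z hz
  obtain ⟨R, hR, hRU, C, hC⟩ := exists_forall_norm_fderiv_le hU hf hz
  obtain ⟨r, hr, hrv⟩ : ∃ r > 0, r * ‖v‖ < R / 2 :=
    ⟨R / 2 / (‖v‖ + 1), by positivity, by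
      rw [div_mul_eq_mul_div, div_lt_iff₀ (by positivity)]; gcongr; linarith⟩
  have hmem : ∀ w ∈ ball z (R / 2), ∀ ζ ∈ closedBall (0 : ℂ) r, w + ζ • v ∈ ball z R := by
    intro w hw ζ hζ
    rw [mem_ball, dist_eq_norm] at hw ⊢
    calc ‖w + ζ • v - z‖ = ‖(w - z) + ζ • v‖ := by congr 1; abel
      _ ≤ ‖w - z‖ + ‖ζ‖ * ‖v‖ := (norm_add_le _ _).trans_eq (by rw [norm_smul])
      _ ≤ ‖w - z‖ + r * ‖v‖ := by gcongr; exact mem_closedBall_zero_iff.1 hζ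
      _ < R := by linarith
  have hhalf : ball z (R / 2) ∈ 𝓝 z := ball_mem_nhds z (half_pos hR)
  have hsphere : ∀ w ∈ ball z (R / 2), ∀ ζ ∈ sphere (0 : ℂ) |r|, w + ζ • v ∈ ball z R :=
    fun w hw ζ hζ => hmem w hw ζ (sphere_subset_closedBall (abs_of_pos hr ▸ hζ))
  have hκ : ContinuousOn (fun ζ : ℂ => (ζ ^ 2)⁻¹) (sphere 0 |r|) := by
    refine (continuousOn_id.pow 2).inv₀ fun ζ hζ => pow_ne_zero 2 ?_
    exact ne_zero_of_mem_sphere (abs_pos.2 hr.ne').ne' ⟨ζ, hζ⟩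
  refine (DifferentiableAt.congr_of_eventuallyEq
    ((differentiableAt_circleIntegral_add_smul hκ hhalf
      (fun w hw ζ hζ => hf.differentiableAt (hU.mem_nhds (hRU (hsphere w hw ζ hζ))))
      (fun w hw ζ hζ => hC _ (hsphere w hw ζ hζ))).const_smul
        (2 * Real.pi * Complex.I : ℂ)⁻¹) ?_).differentiableWithinAt
  filter_upwards [hhalf] with w hw
  exact fderiv_apply_eq_circleIntegral hU hf hr fun ζ hζ => hRU (hmem w hw ζ hζ)

theorem continuousOn_fderiv_of_differentiableOn (hU : IsOpen U) (hf : DifferentiableOn ℂ f U) :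
    ContinuousOn (fderiv ℂ f) U :=
  continuousOn_clm_apply.2 fun v => (differentiableOn_fderiv_apply hU hf v).continuousOn

theorem contDiffOn_of_differentiableOn (k : ℕ) (hU : IsOpen U) (hf : DifferentiableOn ℂ f U) :
    ContDiffOn ℂ k f U := by
  induction k generalizing f with
  | zero => exact contDiffOn_zero.2 hf.continuousOn
  | succ k ih =>
    rw [Nat.cast_succ]
    refine (contDiffOn_succ_iff_fderiv_apply hU.uniqueDiffOn).2 ⟨hf, by simp, fun v => ?_⟩
    exact (ih (differentiableOn_fderiv_apply hU hf v)).congr fun z hz => by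
      rw [fderivWithin_of_isOpen hU hz]

theorem fderiv_fderiv_apply_comm (hU : IsOpen U) (hf : DifferentiableOn ℂ f U) {z : E}
    (hz : z ∈ U) (v w : E) :
    fderiv ℂ (fun y => fderiv ℂ f y v) z w = fderiv ℂ (fun y => fderiv ℂ f y w) z v := by
  have hcont : ContDiffAt ℂ 2 f z :=
    (contDiffOn_of_differentiableOn 2 hU hf).contDiffAt (hU.mem_nhds hz)
  have hdiff : DifferentiableAt ℂ (fderiv ℂ f) z :=
    (hcont.fderiv_right (m := 1) (by norm_num)).differentiableAt one_ne_zero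
  have hsymm : IsSymmSndFDerivAt ℂ f z :=
    hcont.isSymmSndFDerivAt minSmoothness_of_isRCLikeNormedField.le
  rw [fderiv_clm_apply hdiff (by fun_prop), fderiv_clm_apply hdiff (by fun_prop)]
  simpa using hsymm w v

end Regularity

section Taylor

open Filter Metric Finset Set

theorem clm_apply_eq_sum_single {ι R M : Type*} [Fintype ι] [DecidableEq ι] [Semiring R]
    [TopologicalSpace R] [AddCommMonoid M] [TopologicalSpace M] [Module R M]
    (A : (ι → R) →L[R] M) (w : ι → R) : A w = ∑ l, w l • A (Pi.single l 1) := by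
  conv_lhs => rw [pi_eq_sum_univ' w, map_sum]
  simp only [map_smul]

theorem noncommProd_smul_pow {R A ι : Type*} [CommSemiring R] [Semiring A] [Algebra R A]
    (s : Finset ι) (c : ι → R) (x : ι → A) (β : ι → ℕ)
    (hx : (s : Set ι).Pairwise (Function.onFun Commute fun i => x i ^ β i))
    (hcx : (s : Set ι).Pairwise (Function.onFun Commute fun i => (c i • x i) ^ β i)) :
    s.noncommProd (fun i => (c i • x i) ^ β i) hcx
      = (∏ i ∈ s, c i ^ β i) • s.noncommProd (fun i => x i ^ β i) hx := by
  classical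
  induction s using Finset.induction_on with
  | empty => simp
  | insert a s ha ih =>
    rw [noncommProd_insert_of_notMem _ _ _ _ ha, noncommProd_insert_of_notMem _ _ _ _ ha,
      prod_insert ha, ih (hx.mono (by simp)), smul_pow, smul_mul_smul_comm]

theorem hasDerivAt_comp_smul {E G : Type*} [NormedAddCommGroup E] [NormedSpace ℂ E]
    [NormedAddCommGroup G] [NormedSpace ℂ G] {U : Set E} {f : E → G} (hU : IsOpen U)
    (hf : DifferentiableOn ℂ f U) {w : E} {ζ : ℂ} (hζ : ζ • w ∈ U) :
    HasDerivAt (fun ζ : ℂ => f (ζ • w)) (fderiv ℂ f (ζ • w) w) ζ :=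
  (hf.differentiableAt (hU.mem_nhds hζ)).hasFDerivAt.comp_hasDerivAt ζ
    (by simpa using (hasDerivAt_id ζ).smul_const w)

theorem isOpen_setOf_smul_mem {E : Type*} [NormedAddCommGroup E] [NormedSpace ℂ E] {U : Set E}
    (hU : IsOpen U) (w : E) : IsOpen {ζ : ℂ | ζ • w ∈ U} :=
  hU.preimage (by fun_prop)

variable {n : ℕ} {U : Set (Fin n → ℂ)} {f g : (Fin n → ℂ) → ℂ}

theorem partialDeriv_congr (hU : IsOpen U) (h : EqOn f g U) (l : Fin n) :
    EqOn (partialDeriv l f) (partialDeriv l g) U := fun z hz => by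
  simp only [partialDeriv, (h.eventuallyEq_of_mem (hU.mem_nhds hz)).fderiv_eq]

theorem iterate_partialDeriv_congr (hU : IsOpen U) (h : EqOn f g U) (l : Fin n) (k : ℕ) :
    EqOn ((partialDeriv l)^[k] f) ((partialDeriv l)^[k] g) U := by
  induction k with
  | zero => exact h
  | succ k ih =>
    simp only [Function.iterate_succ_apply']
    exact partialDeriv_congr hU ih l

theorem mixedDeriv_congr (hU : IsOpen U) (h : EqOn f g U) (β : Fin n → ℕ) :
    EqOn (mixedDeriv β f) (mixedDeriv β g) U := by
  unfold mixedDeriv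
  induction List.finRange n with
  | nil => exact h
  | cons l L ih => exact iterate_partialDeriv_congr hU ih l (β l)

/-- Functions on `ℂⁿ` that are holomorphic on `U`, normalised to vanish outside `U` so that they
are determined by their restriction to `U`. Partial derivatives act on this space as commuting
operators, which is what the multinomial theorem requires. -/
def holomorphicSubmodule (U : Set (Fin n → ℂ)) : Submodule ℂ ((Fin n → ℂ) → ℂ) where
  carrier := {g | DifferentiableOn ℂ g U ∧ ∀ z ∉ U, g z = 0}
  add_mem' ha hb := ⟨ha.1.add hb.1, fun z hz => by simp [ha.2 z hz, hb.2 z hz]⟩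
  zero_mem' := ⟨differentiableOn_const 0, fun _ _ => rfl⟩
  smul_mem' c _ ha := ⟨ha.1.const_smul c, fun z hz => by simp [ha.2 z hz]⟩

theorem indicator_mem_holomorphicSubmodule (hf : DifferentiableOn ℂ f U) :
    U.indicator f ∈ holomorphicSubmodule U :=
  ⟨hf.congr fun _ hz => indicator_of_mem hz f, fun _ hz => indicator_of_notMem hz f⟩

theorem holomorphicSubmodule_ext {f g : holomorphicSubmodule U} (h : EqOn f.1 g.1 U) : f = g := by
  ext z
  by_cases hz : z ∈ U
  · exact h hz
  · rw [f.2.2 z hz, g.2.2 z hz]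

/-- The partial derivative `∂/∂z_l` as an operator on the functions holomorphic on `U`. -/
noncomputable def partialOp (hU : IsOpen U) (l : Fin n) :
    Module.End ℂ (holomorphicSubmodule U) where
  toFun g := ⟨U.indicator (partialDeriv l g.1),
    indicator_mem_holomorphicSubmodule (differentiableOn_fderiv_apply hU g.2.1 _)⟩
  map_add' f g := holomorphicSubmodule_ext fun z hz => by
    have hf := f.2.1.differentiableAt (hU.mem_nhds hz)
    have hg := g.2.1.differentiableAt (hU.mem_nhds hz)
    simp [hz, partialDeriv, fderiv_add hf hg]
  map_smul' c g := holomorphicSubmodule_ext fun z hz => by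
    have hg := g.2.1.differentiableAt (hU.mem_nhds hz)
    simp [hz, partialDeriv, fderiv_const_smul hg]

theorem partialOp_eqOn (hU : IsOpen U) (l : Fin n) (g : holomorphicSubmodule U) :
    EqOn (partialOp hU l g).1 (partialDeriv l g.1) U :=
  fun _ hz => indicator_of_mem hz _

theorem partialOp_commute (hU : IsOpen U) (l m : Fin n) :
    Commute (partialOp hU l) (partialOp hU m) :=
  LinearMap.ext fun g => holomorphicSubmodule_ext fun z hz => by
    rw [Module.End.mul_apply, Module.End.mul_apply, partialOp_eqOn hU l _ hz,
      partialOp_eqOn hU m _ hz, partialDeriv_congr hU (partialOp_eqOn hU m g) l hz,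
      partialDeriv_congr hU (partialOp_eqOn hU l g) m hz]
    exact fderiv_fderiv_apply_comm hU g.2.1 hz _ _

theorem partialOp_pow_eqOn (hU : IsOpen U) (l : Fin n) (k : ℕ) (g : holomorphicSubmodule U) :
    EqOn ((partialOp hU l ^ k) g).1 ((partialDeriv l)^[k] g.1) U := by
  induction k with
  | zero => exact fun _ _ => rfl
  | succ k ih =>
    rw [pow_succ', Function.iterate_succ_apply', Module.End.mul_apply]
    exact (partialOp_eqOn hU l _).trans (partialDeriv_congr hU ih l)

theorem noncommProd_partialOp_eqOn (hU : IsOpen U) (β : Fin n → ℕ) (g : holomorphicSubmodule U)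
    (hc : ((univ : Finset (Fin n)) : Set (Fin n)).Pairwise
      (Function.onFun Commute fun l => partialOp hU l ^ β l)) :
    EqOn ((univ : Finset (Fin n)).noncommProd (fun l => partialOp hU l ^ β l) hc g).1
      (mixedDeriv β g.1) U := by
  have hprod : (univ : Finset (Fin n)).noncommProd (fun l => partialOp hU l ^ β l) hc
      = ((List.finRange n).map fun l => partialOp hU l ^ β l).prod := by
    rw [noncommProd_congr (List.toFinset_finRange n).symm (fun _ _ => rfl)]
    exact noncommProd_toFinset _ _ _ (List.nodup_finRange n)
  rw [hprod]
  unfold mixedDeriv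
  induction List.finRange n with
  | nil => exact fun _ _ => rfl
  | cons l L ih =>
    rw [List.map_cons, List.prod_cons, List.foldr_cons, Module.End.mul_apply]
    exact (partialOp_pow_eqOn hU l _ _).trans (iterate_partialDeriv_congr hU ih l _)

/-- The directional derivative `∑ w_l ∂/∂z_l` as an operator on the functions holomorphic
on `U`. -/
noncomputable def directionalOp (hU : IsOpen U) (w : Fin n → ℂ) :
    Module.End ℂ (holomorphicSubmodule U) :=
  ∑ l, w l • partialOp hU l

theorem directionalOp_apply (hU : IsOpen U) (w : Fin n → ℂ) (g : holomorphicSubmodule U)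
    {z : Fin n → ℂ} (hz : z ∈ U) : (directionalOp hU w g).1 z = fderiv ℂ g.1 z w := by
  rw [clm_apply_eq_sum_single]
  simp only [directionalOp, LinearMap.sum_apply, LinearMap.smul_apply, Submodule.coe_sum,
    Submodule.coe_smul, Finset.sum_apply, Pi.smul_apply]
  exact sum_congr rfl fun l _ => by rw [partialOp_eqOn hU l g hz, partialDeriv]

theorem hasDerivAt_slice (hU : IsOpen U) (g : holomorphicSubmodule U) (w : Fin n → ℂ) {ζ : ℂ}
    (hζ : ζ • w ∈ U) :
    HasDerivAt (fun ζ : ℂ => g.1 (ζ • w)) ((directionalOp hU w g).1 (ζ • w)) ζ := by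
  rw [directionalOp_apply hU w g hζ]
  exact hasDerivAt_comp_smul hU g.2.1 hζ

theorem iteratedDeriv_slice (hU : IsOpen U) (g : holomorphicSubmodule U) (w : Fin n → ℂ) (d : ℕ)
    {ζ : ℂ} (hζ : ζ • w ∈ U) :
    iteratedDeriv d (fun ζ : ℂ => g.1 (ζ • w)) ζ = ((directionalOp hU w ^ d) g).1 (ζ • w) := by
  induction d generalizing ζ with
  | zero => simp
  | succ d ih =>
    have hnear : iteratedDeriv d (fun ζ : ℂ => g.1 (ζ • w)) =ᶠ[𝓝 ζ]
        fun ζ => ((directionalOp hU w ^ d) g).1 (ζ • w) := by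
      filter_upwards [(isOpen_setOf_smul_mem hU w).mem_nhds hζ] with y hy using ih hy
    rw [iteratedDeriv_succ, pow_succ', Module.End.mul_apply, hnear.deriv_eq]
    exact (hasDerivAt_slice hU _ w hζ).deriv

/-- The homogeneous part of degree `d` of the Taylor series at `0`. -/
noncomputable def taylorHomogeneous (f : (Fin n → ℂ) → ℂ) (d : ℕ) (w : Fin n → ℂ) : ℂ :=
  ∑ β ∈ piAntidiag univ d, taylorCoeff f β * monomial β w

theorem taylorHomogeneous_congr (hU : IsOpen U) (h0 : 0 ∈ U) (h : EqOn f g U) (d : ℕ)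
    (w : Fin n → ℂ) : taylorHomogeneous f d w = taylorHomogeneous g d w := by
  simp only [taylorHomogeneous, taylorCoeff, mixedDeriv_congr hU h _ h0]

theorem prod_factorial_mul_taylorCoeff (f : (Fin n → ℂ) → ℂ) (β : Fin n → ℕ) :
    ((∏ l, (β l).factorial : ℕ) : ℂ) * taylorCoeff f β = mixedDeriv β f 0 :=
  mul_div_cancel₀ _ <| Nat.cast_ne_zero.2 <| prod_ne_zero_iff.2 fun l _ => (β l).factorial_ne_zero

theorem directionalOp_pow_apply_zero (hU : IsOpen U) (h0 : 0 ∈ U) (g : holomorphicSubmodule U)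
    (w : Fin n → ℂ) (d : ℕ) :
    ((directionalOp hU w ^ d) g).1 0 = d.factorial * taylorHomogeneous g.1 d w := by
  have hcomm_smul : ((univ : Finset (Fin n)) : Set (Fin n)).Pairwise
      (Function.onFun Commute fun l => w l • partialOp hU l) := fun l _ m _ _ =>
    ((partialOp_commute hU l m).smul_left _).smul_right _
  rw [directionalOp, sum_pow_eq_sum_piAntidiag_of_commute _ _ hcomm_smul, taylorHomogeneous,
    mul_sum, LinearMap.sum_apply, Submodule.coe_sum, Finset.sum_apply]
  refine sum_congr rfl fun β hβ => ?_
  have hcomm : ((univ : Finset (Fin n)) : Set (Fin n)).Pairwise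
      (Function.onFun Commute fun l => partialOp hU l ^ β l) := fun l _ m _ _ =>
    (partialOp_commute hU l m).pow_pow _ _
  have hmultinomial : (d.factorial : ℂ)
      = ((∏ l, (β l).factorial : ℕ) : ℂ) * (Nat.multinomial univ β : ℂ) := by
    rw [← (mem_piAntidiag.1 hβ).1]
    exact_mod_cast (Nat.multinomial_spec univ β).symm
  rw [noncommProd_smul_pow _ _ _ _ hcomm, ← nsmul_eq_mul, ← Nat.cast_smul_eq_nsmul ℂ]
  simp only [LinearMap.smul_apply, Submodule.coe_smul, Pi.smul_apply, smul_eq_mul]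
  rw [noncommProd_partialOp_eqOn hU β g hcomm h0, ← prod_factorial_mul_taylorCoeff, hmultinomial,
    monomial]
  ring

theorem factorial_mul_taylorHomogeneous (hU : IsOpen U) (h0 : 0 ∈ U)
    (hf : DifferentiableOn ℂ f U) (d : ℕ) (w : Fin n → ℂ) :
    d.factorial * taylorHomogeneous f d w = iteratedDeriv d (fun ζ : ℂ => f (ζ • w)) 0 := by
  let g : holomorphicSubmodule U := ⟨U.indicator f, indicator_mem_holomorphicSubmodule hf⟩
  have hg : EqOn g.1 f U := fun z hz => indicator_of_mem hz f
  have h0w : (0 : ℂ) • w ∈ U := (zero_smul ℂ w).symm ▸ h0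
  have hslice : (fun ζ : ℂ => f (ζ • w)) =ᶠ[𝓝 0] fun ζ => g.1 (ζ • w) :=
    eventually_of_mem ((isOpen_setOf_smul_mem hU w).mem_nhds h0w) fun ζ hζ => (hg hζ).symm
  rw [hslice.iteratedDeriv_eq, iteratedDeriv_slice hU g w d h0w, zero_smul,
    directionalOp_pow_apply_zero hU h0, taylorHomogeneous_congr hU h0 hg]

theorem taylorHomogeneous_zero (hU : IsOpen U) (h0 : 0 ∈ U) (hf : DifferentiableOn ℂ f U)
    (w : Fin n → ℂ) : taylorHomogeneous f 0 w = f 0 := by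
  simpa using factorial_mul_taylorHomogeneous hU h0 hf 0 w

theorem taylorHomogeneous_one (hU : IsOpen U) (h0 : 0 ∈ U) (hf : DifferentiableOn ℂ f U)
    (w : Fin n → ℂ) : taylorHomogeneous f 1 w = fderiv ℂ f 0 w := by
  have hderiv := hasDerivAt_comp_smul hU hf (w := w) (ζ := 0) (by simpa using h0)
  simpa [hderiv.deriv] using factorial_mul_taylorHomogeneous hU h0 hf 1 w

theorem eventually_hasSum_taylorHomogeneous (hU : IsOpen U) (h0 : 0 ∈ U)
    (hf : DifferentiableOn ℂ f U) (w : Fin n → ℂ) :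
    ∀ᶠ ζ : ℂ in 𝓝 0, HasSum (fun d => taylorHomogeneous f d w * ζ ^ d) (f (ζ • w)) := by
  obtain ⟨r, hr, hball⟩ := Metric.isOpen_iff.1 (isOpen_setOf_smul_mem hU w) 0 (by simpa using h0)
  have hdiff : DifferentiableOn ℂ (fun ζ : ℂ => f (ζ • w)) (ball 0 r) := fun ζ hζ =>
    (hasDerivAt_comp_smul hU hf (hball hζ)).differentiableAt.differentiableWithinAt
  filter_upwards [ball_mem_nhds (0 : ℂ) hr] with ζ hζ
  refine (Complex.hasSum_taylorSeries_on_ball hdiff hζ).congr_fun fun d => ?_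
  have hfact : (d.factorial : ℂ) ≠ 0 := Nat.cast_ne_zero.2 d.factorial_ne_zero
  rw [← factorial_mul_taylorHomogeneous hU h0 hf, sub_zero, smul_eq_mul, smul_eq_mul]
  field_simp

end Taylor

section PowerSeries

open Filter

theorem coeff_eq_of_eventually_hasSum {a b : ℕ → ℂ} {f : ℂ → ℂ}
    (ha : ∀ᶠ ζ : ℂ in 𝓝 0, HasSum (fun d => a d * ζ ^ d) (f ζ))
    (hb : ∀ᶠ ζ : ℂ in 𝓝 0, HasSum (fun d => b d * ζ ^ d) (f ζ)) : a = b := by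
  have hasFPowerSeriesAt : ∀ c : ℕ → ℂ, (∀ᶠ ζ : ℂ in 𝓝 0, HasSum (fun d => c d * ζ ^ d) (f ζ)) →
      HasFPowerSeriesAt f (FormalMultilinearSeries.ofScalars ℂ c) 0 := fun c hc => by
    rw [hasFPowerSeriesAt_iff]
    filter_upwards [hc] with ζ hζ
    simpa [FormalMultilinearSeries.coeff_ofScalars, mul_comm] using hζ
  have heq := (hasFPowerSeriesAt a ha).eq_formalMultilinearSeries (hasFPowerSeriesAt b hb)
  funext d
  simpa [FormalMultilinearSeries.coeff_ofScalars] using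
    congrArg (fun p => FormalMultilinearSeries.coeff p d) heq

theorem hasSum_pow_mul_shift {a : ℕ → ℂ} {ζ s : ℂ} (m : ℕ)
    (h : HasSum (fun d => a d * ζ ^ d) s) :
    HasSum (fun d => (if d < m then 0 else a (d - m)) * ζ ^ d) (ζ ^ m * s) := by
  rw [← hasSum_nat_add_iff' m, Finset.sum_eq_zero fun i hi => by simp [Finset.mem_range.1 hi],
    sub_zero]
  refine (h.mul_left (ζ ^ m)).congr_fun fun d => ?_
  rw [if_neg (by omega), Nat.add_sub_cancel]
  ring

end PowerSeries

section Monomials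

open Finset

variable {n : ℕ} {α β : Fin n → ℕ} {l q : Fin n}

theorem degree_add (α β : Fin n → ℕ) : degree (α + β) = degree α + degree β :=
  sum_add_distrib

theorem degree_single_one (l : Fin n) : degree (Pi.single l 1) = 1 := by
  simp [degree]

theorem degree_eq_zero_iff : degree α = 0 ↔ α = 0 := by
  simp [degree, funext_iff]

theorem sub_single_add_single_self (hl : α l ≠ 0) :
    α - Pi.single l 1 + Pi.single l 1 = α := by
  refine tsub_add_cancel_of_le fun i => ?_
  rcases eq_or_ne i l with rfl | hi
  · simpa using Nat.one_le_iff_ne_zero.2 hl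
  · simp [hi]

theorem degree_sub_single_add_one (hl : α l ≠ 0) : degree (α - Pi.single l 1) + 1 = degree α := by
  have h := congrArg degree (sub_single_add_single_self hl)
  rwa [degree_add, degree_single_one] at h

theorem degree_sub_single_add_single (hl : α l ≠ 0) (q : Fin n) :
    degree (α - Pi.single l 1 + Pi.single q 1) = degree α := by
  rw [degree_add, degree_single_one, degree_sub_single_add_one hl]

theorem sub_single_add_single_eq_self_iff (hl : α l ≠ 0) :
    α - Pi.single l 1 + Pi.single q 1 = α ↔ q = l := by
  refine ⟨fun h => ?_, fun h => by rw [h, sub_single_add_single_self hl]⟩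
  have hsingle := congrFun (add_left_cancel (h.trans (sub_single_add_single_self hl).symm)) q
  by_contra hne
  simp [hne] at hsingle

theorem monomialKey_lt_monomialKey : monomialKey α < monomialKey β ↔ MonomialLT α β :=
  ⟨monomialLT_of_key, fun h => Prod.Lex.toLex_lt_toLex.2 <|
    h.imp_right fun ⟨hdeg, j, hj, hlt⟩ => ⟨hdeg, j, hlt, hj⟩⟩

theorem monomialLT_sub_single_add_single (hl : α l ≠ 0) (hlq : l < q) :
    MonomialLT α (α - Pi.single l 1 + Pi.single q 1) := by
  refine Or.inr ⟨(degree_sub_single_add_single hl q).symm, l, ?_, fun i hi => ?_⟩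
  · simp [hlq.ne]
    omega
  · simp [hi.ne, (hi.trans hlq).ne]

theorem monomial_smul (β : Fin n → ℕ) (ζ : ℂ) (w : Fin n → ℂ) :
    monomial β (ζ • w) = monomial β w * ζ ^ degree β := by
  simp only [monomial, Pi.smul_apply, smul_eq_mul, mul_pow, prod_mul_distrib, degree,
    prod_pow_eq_pow_sum, mul_comm]

theorem monomial_add_single (α : Fin n → ℕ) (q : Fin n) (w : Fin n → ℂ) :
    monomial (α + Pi.single q 1) w = monomial α w * w q := by
  simp only [monomial, Pi.add_apply, pow_add, prod_mul_distrib]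
  congr 1
  rw [prod_eq_single q] <;> simp +contextual

theorem hasFDerivAt_monomial (α : Fin n → ℕ) (w : Fin n → ℂ) :
    HasFDerivAt (monomial α) (∑ l, ((α l : ℂ) * monomial (α - Pi.single l 1) w) •
      ContinuousLinearMap.proj (R := ℂ) (φ := fun _ => ℂ) l) w := by
  have hpow : ∀ l ∈ univ, HasFDerivAt (fun z : Fin n → ℂ => z l ^ α l)
      ((α l * w l ^ (α l - 1)) • ContinuousLinearMap.proj (R := ℂ) (φ := fun _ => ℂ) l) w :=
    fun l _ => ((hasFDerivAt_apply (𝕜 := ℂ) l w).pow (α l)).congr_fderiv (by ext; simp)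
  refine (HasFDerivAt.finsetProd hpow).congr_fderiv (sum_congr rfl fun l _ => ?_)
  have hfactor : ∀ i ∈ univ.erase l, w i ^ (α - Pi.single l 1 : Fin n → ℕ) i = w i ^ α i :=
    fun i hi => by simp [ne_of_mem_erase hi]
  rw [smul_smul, monomial, ← mul_prod_erase univ _ (mem_univ l), prod_congr rfl hfactor,
    Pi.sub_apply, Pi.single_eq_same]
  congr 1
  ring

theorem differentiable_monomial (α : Fin n → ℕ) : Differentiable ℂ (monomial α) :=
  fun w => (hasFDerivAt_monomial α w).differentiableAt

theorem mem_piAntidiag_univ {d : ℕ} : β ∈ piAntidiag univ d ↔ degree β = d := by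
  simp [degree]

theorem coeff_eq_of_forall_sum_eq {d : ℕ} {c c' : (Fin n → ℕ) → ℂ}
    (h : ∀ w, ∑ β ∈ piAntidiag univ d, c β * monomial β w
      = ∑ β ∈ piAntidiag univ d, c' β * monomial β w) (hβ : degree β = d) : c β = c' β := by
  let p : ((Fin n → ℕ) → ℂ) → MvPolynomial (Fin n) ℂ := fun c =>
    ∑ β ∈ piAntidiag univ d, MvPolynomial.monomial (Finsupp.equivFunOnFinite.symm β) (c β)
  have heval : ∀ c w, MvPolynomial.eval w (p c)
      = ∑ β ∈ piAntidiag univ d, c β * monomial β w := fun c w => by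
    simp [p, MvPolynomial.eval_monomial, monomial, Finsupp.prod_fintype]
  have hcoeff : ∀ c, MvPolynomial.coeff (Finsupp.equivFunOnFinite.symm β) (p c) = c β :=
    fun c => by
      simp only [p, MvPolynomial.coeff_sum, MvPolynomial.coeff_monomial,
        EmbeddingLike.apply_eq_iff_eq, sum_ite_eq', mem_piAntidiag_univ, hβ, if_true]
  have hp : p c = p c' := MvPolynomial.funext fun w => by rw [heval, heval, h w]
  rw [← hcoeff c, hp, hcoeff]

end Monomials

section MonomialEnum

variable {n : ℕ} [NeZero n]

theorem degree_monomialEnum_mono : Monotone fun k => degree (monomialEnum n k) :=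
  monotone_nat_of_le_succ fun k => by
    rcases monomialEnum_lt n k.lt_succ_self with h | h
    exacts [h.le, h.1.le]

theorem monomialEnum_zero : monomialEnum n 0 = 0 := by
  obtain ⟨k, hk⟩ := (monomialEnum_bijective n).2 0
  have hdeg : degree (monomialEnum n 0) ≤ degree (monomialEnum n k) :=
    degree_monomialEnum_mono k.zero_le
  rw [hk, degree_eq_zero_iff.2 rfl] at hdeg
  exact degree_eq_zero_iff.1 (Nat.le_zero.1 hdeg)

theorem degree_monomialEnum_ne_zero {k : ℕ} (hk : 1 ≤ k) : degree (monomialEnum n k) ≠ 0 := by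
  rw [Ne, degree_eq_zero_iff, ← monomialEnum_zero, (monomialEnum_bijective n).1.eq_iff]
  omega

end MonomialEnum

section Coefficients

open Filter Finset

variable {n : ℕ} {U : Set (Fin n → ℂ)} {F : (Fin n → ℂ) → (Fin n → ℂ)} {α β : Fin n → ℕ}

theorem taylorCoeff_monomial (α β : Fin n → ℕ) :
    taylorCoeff (monomial α) β = if β = α then 1 else 0 := by
  have hslice : ∀ w, (fun d => taylorHomogeneous (monomial α) d w)
      = fun d => if d = degree α then monomial α w else 0 := fun w =>
    coeff_eq_of_eventually_hasSum
      (eventually_hasSum_taylorHomogeneous isOpen_univ (Set.mem_univ 0)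
        (differentiable_monomial α).differentiableOn w)
      (Eventually.of_forall fun ζ => by
        rw [monomial_smul]
        exact (hasSum_ite_eq (degree α) (monomial α w * ζ ^ degree α)).congr_fun fun d => by
          split_ifs with h <;> simp [h])
  refine coeff_eq_of_forall_sum_eq (c := taylorCoeff (monomial α))
    (c' := fun β => if β = α then 1 else 0) (d := degree β) (fun w => ?_) rfl
  refine (congrFun (hslice w) (degree β)).trans ?_
  simp only [ite_mul, one_mul, zero_mul, sum_ite_eq', mem_piAntidiag_univ, eq_comm (a := degree α)]

theorem hardyInner_monomial (f : (Fin n → ℂ) → ℂ) (α : Fin n → ℕ) :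
    hardyInner f (monomial α) = taylorCoeff f α := by
  rw [hardyInner, tsum_eq_single α fun β hβ => by simp [taylorCoeff_monomial, hβ]]
  simp [taylorCoeff_monomial]

theorem koopmanGenerator_monomial (F : (Fin n → ℂ) → (Fin n → ℂ)) (α : Fin n → ℕ)
    (w : Fin n → ℂ) : koopmanGenerator F (monomial α) w
      = ∑ l, (α l : ℂ) * monomial (α - Pi.single l 1) w * F w l := by
  simp [koopmanGenerator, (hasFDerivAt_monomial α w).fderiv]

theorem differentiableOn_koopmanGenerator (hF : DifferentiableOn ℂ F U) (α : Fin n → ℕ) :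
    DifferentiableOn ℂ (koopmanGenerator F (monomial α)) U := by
  rw [funext (koopmanGenerator_monomial F α)]
  exact .fun_sum fun l _ => ((differentiable_monomial _).differentiableOn.const_mul _).mul
    (differentiableOn_pi.1 hF l)

theorem koopmanGenerator_monomial_smul (F : (Fin n → ℂ) → (Fin n → ℂ)) (α : Fin n → ℕ) (ζ : ℂ)
    (w : Fin n → ℂ) : koopmanGenerator F (monomial α) (ζ • w) = ζ ^ (degree α - 1) *
      ∑ l, (α l : ℂ) * monomial (α - Pi.single l 1) w * F (ζ • w) l := by
  rw [koopmanGenerator_monomial, mul_sum]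
  refine sum_congr rfl fun l _ => ?_
  by_cases hl : α l = 0
  · simp [hl]
  · rw [monomial_smul, ← degree_sub_single_add_one hl, Nat.add_sub_cancel]
    ring

theorem taylorHomogeneous_koopmanGenerator (hU : IsOpen U) (h0 : 0 ∈ U)
    (hF : DifferentiableOn ℂ F U) (α : Fin n → ℕ) (d : ℕ) (w : Fin n → ℂ) :
    taylorHomogeneous (koopmanGenerator F (monomial α)) d w =
      if d < degree α - 1 then 0 else ∑ l, (α l : ℂ) * monomial (α - Pi.single l 1) w *
        taylorHomogeneous (fun z => F z l) (d - (degree α - 1)) w := by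
  let b : ℕ → ℂ := fun d => ∑ l, (α l : ℂ) * monomial (α - Pi.single l 1) w *
    taylorHomogeneous (fun z => F z l) d w
  suffices hb : (fun d => taylorHomogeneous (koopmanGenerator F (monomial α)) d w)
      = fun d => if d < degree α - 1 then 0 else b (d - (degree α - 1)) from congrFun hb d
  refine coeff_eq_of_eventually_hasSum
    (eventually_hasSum_taylorHomogeneous hU h0 (differentiableOn_koopmanGenerator hF α) w) ?_
  have hsum := fun l =>
    eventually_hasSum_taylorHomogeneous hU h0 (differentiableOn_pi.1 hF l) w
  filter_upwards [eventually_all.2 hsum] with ζ hζ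
  rw [koopmanGenerator_monomial_smul]
  refine hasSum_pow_mul_shift _ ((hasSum_sum fun l _ => (hζ l).mul_left _).congr_fun fun d => ?_)
  rw [sum_mul]
  exact sum_congr rfl fun l _ => by ring

theorem jacobian_apply (F : (Fin n → ℂ) → (Fin n → ℂ)) (z : Fin n → ℂ) (l q : Fin n) :
    jacobian F z l q = fderiv ℂ F z (Pi.single q 1) l := by
  simp [jacobian, LinearMap.toMatrix'_apply]

theorem fderiv_apply_eq_sum_jacobian (F : (Fin n → ℂ) → (Fin n → ℂ)) (z w : Fin n → ℂ)
    (l : Fin n) : fderiv ℂ F z w l = ∑ q, w q * jacobian F z l q := by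
  rw [clm_apply_eq_sum_single, Finset.sum_apply]
  simp [jacobian_apply]

theorem taylorHomogeneous_koopmanGenerator_of_le (hU : IsOpen U) (h0 : 0 ∈ U)
    (hF : DifferentiableOn ℂ F U) (hF0 : F 0 = 0) (hα : degree α ≠ 0) {d : ℕ}
    (hd : d ≤ degree α) (w : Fin n → ℂ) :
    taylorHomogeneous (koopmanGenerator F (monomial α)) d w = if d = degree α then
      ∑ l, (α l : ℂ) * monomial (α - Pi.single l 1) w * ∑ q, w q * jacobian F 0 l q else 0 := by
  have hFl := fun l => differentiableOn_pi.1 hF l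
  rw [taylorHomogeneous_koopmanGenerator hU h0 hF]
  obtain hlt | rfl | rfl : d < degree α - 1 ∨ d = degree α - 1 ∨ d = degree α := by omega
  · rw [if_pos hlt, if_neg (by omega)]
  · rw [if_neg (by omega), if_neg (by omega), Nat.sub_self]
    simp [taylorHomogeneous_zero hU h0 (hFl _), hF0]
  · rw [if_neg (by omega), if_pos rfl, Nat.sub_sub_self (by omega)]
    refine sum_congr rfl fun l _ => ?_
    have hFl0 := fun l => (hFl l).differentiableAt (hU.mem_nhds h0)
    rw [taylorHomogeneous_one hU h0 (hFl l), ← fderiv_apply_eq_sum_jacobian, fderiv_pi hFl0]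
    rfl

theorem sum_piAntidiag_sum_ite {ι : Type*} [Fintype ι] (c : ι → ℂ) (γ : ι → Fin n → ℕ) {N : ℕ}
    (h : ∀ i, c i ≠ 0 → degree (γ i) = N) (d : ℕ) (w : Fin n → ℂ) :
    ∑ β ∈ piAntidiag univ d, (∑ i, if β = γ i then c i else 0) * monomial β w
      = if d = N then ∑ i, c i * monomial (γ i) w else 0 := by
  simp only [sum_mul, ite_mul, zero_mul]
  rw [sum_comm]
  have hdegree : ∀ i, (if degree (γ i) = d then c i * monomial (γ i) w else 0)
      = if d = N then c i * monomial (γ i) w else 0 := fun i => by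
    by_cases hi : c i = 0
    · simp [hi]
    · simp only [h i hi, eq_comm]
  simp only [sum_ite_eq', mem_piAntidiag_univ, hdegree]
  split_ifs <;> simp

theorem taylorCoeff_koopmanGenerator (hU : IsOpen U) (h0 : 0 ∈ U)
    (hF : DifferentiableOn ℂ F U) (hF0 : F 0 = 0) (hα : degree α ≠ 0)
    (hβ : degree β ≤ degree α) :
    taylorCoeff (koopmanGenerator F (monomial α)) β = ∑ i : Fin n × Fin n,
      if β = α - Pi.single i.1 1 + Pi.single i.2 1 then
        (α i.1 : ℂ) * jacobian F 0 i.1 i.2 else 0 := by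
  refine coeff_eq_of_forall_sum_eq (c := taylorCoeff (koopmanGenerator F (monomial α)))
    (c' := fun β => ∑ i : Fin n × Fin n,
      if β = α - Pi.single i.1 1 + Pi.single i.2 1 then
        (α i.1 : ℂ) * jacobian F 0 i.1 i.2 else 0) (fun w => ?_) rfl
  rw [sum_piAntidiag_sum_ite _ _ (N := degree α) fun i hi =>
    degree_sub_single_add_single (Nat.cast_ne_zero.1 (left_ne_zero_of_mul hi)) _]
  refine (taylorHomogeneous_koopmanGenerator_of_le hU h0 hF hF0 hα hβ w).trans ?_
  simp only [Fintype.sum_prod_type, mul_sum, monomial_add_single]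
  refine if_congr Iff.rfl (sum_congr rfl fun l _ => sum_congr rfl fun q _ => ?_) rfl
  ring

variable [NeZero n]

theorem koopmanEntry_eq_taylorCoeff (F : (Fin n → ℂ) → (Fin n → ℂ)) (k j : ℕ) :
    koopmanEntry F k j
      = taylorCoeff (koopmanGenerator F (monomial (monomialEnum n k))) (monomialEnum n j) :=
  hardyInner_monomial _ _

theorem koopmanEntry_eq_sum (hU : IsOpen U) (h0 : 0 ∈ U) (hF : DifferentiableOn ℂ F U)
    (hF0 : F 0 = 0) {j k : ℕ} (hk : 1 ≤ k) (hjk : j ≤ k) :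
    koopmanEntry F k j = ∑ i : Fin n × Fin n,
      if monomialEnum n j = monomialEnum n k - Pi.single i.1 1 + Pi.single i.2 1 then
        (monomialEnum n k i.1 : ℂ) * jacobian F 0 i.1 i.2 else 0 := by
  rw [koopmanEntry_eq_taylorCoeff, taylorCoeff_koopmanGenerator hU h0 hF hF0
    (degree_monomialEnum_ne_zero hk) (degree_monomialEnum_mono hjk)]

theorem koopmanEntry_eq_zero (hU : IsOpen U) (h0 : 0 ∈ U) (hF : DifferentiableOn ℂ F U)
    (hF0 : F 0 = 0) (hJ : (jacobian F 0).BlockTriangular id) {j k : ℕ} (hjk : j < k) :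
    koopmanEntry F k j = 0 := by
  rw [koopmanEntry_eq_sum hU h0 hF hF0 (by omega) hjk.le]
  refine sum_eq_zero fun ⟨l, q⟩ _ => ite_eq_right_iff.2 fun h => ?_
  by_cases hl : monomialEnum n k l = 0
  · simp [hl]
  have hlt := monomialEnum_lt n hjk
  obtain hlq | rfl | hql := lt_trichotomy l q
  · have hgt := monomialLT_sub_single_add_single hl hlq
    rw [← h] at hgt
    exact absurd (monomialKey_lt_monomialKey.2 hlt) (monomialKey_lt_monomialKey.2 hgt).asymm
  · rw [h, sub_single_add_single_self hl] at hlt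
    exact absurd (monomialKey_lt_monomialKey.2 hlt) (lt_irrefl _)
  · rw [hJ hql, mul_zero]

theorem koopmanEntry_diag (hU : IsOpen U) (h0 : 0 ∈ U) (hF : DifferentiableOn ℂ F U)
    (hF0 : F 0 = 0) {k : ℕ} (hk : 1 ≤ k) :
    koopmanEntry F k k = ∑ l, (monomialEnum n k l : ℂ) * jacobian F 0 l l := by
  rw [koopmanEntry_eq_sum hU h0 hF hF0 hk le_rfl, Fintype.sum_prod_type]
  refine sum_congr rfl fun l _ => ?_
  by_cases hl : monomialEnum n k l = 0
  · simp [hl]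
  · simp only [eq_comm (a := monomialEnum n k), sub_single_add_single_eq_self_iff hl, sum_ite_eq',
      mem_univ, if_true]

end Coefficients

section Solutions

open Metric Filter Set

/-- `x` solves `ẋ = F(x)` on `[0, T]`. As for the trajectories of a switched system, only the right
derivative is prescribed, so that solutions can be glued at switching times. -/
structure IsSolution {E : Type*} [NormedAddCommGroup E] [NormedSpace ℝ E] (F : E → E) (T : ℝ)
    (x : ℝ → E) : Prop where
  continuousOn : ContinuousOn x (Icc 0 T)
  deriv : ∀ t ∈ Ico 0 T, HasDerivWithinAt x (F (x t)) (Ici t) t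

theorem IsSolution.norm_sub_le_mul_exp {E : Type*} [NormedAddCommGroup E] [NormedSpace ℝ E]
    {F : E → E} {T L δ : ℝ} {x y : ℝ → E} (hx : IsSolution F T x) (hy : IsSolution F T y)
    (hL : 0 ≤ L)
    (hF : ∀ t ∈ Icc 0 T, ∀ z, ‖z - x t‖ ≤ δ → ‖F z - F (x t)‖ ≤ L * ‖z - x t‖)
    (h0 : ‖y 0 - x 0‖ * Real.exp ((L + 1) * T) < δ) {t : ℝ} (ht : t ∈ Icc 0 T) :
    ‖y t - x t‖ ≤ ‖y 0 - x 0‖ * Real.exp ((L + 1) * t) := by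
  have hκ : ∀ᶠ κ in 𝓝[>] ‖y 0 - x 0‖, ‖y t - x t‖ ≤ κ * Real.exp ((L + 1) * t) := by
    have hsmall : ∀ᶠ κ in 𝓝 ‖y 0 - x 0‖, κ * Real.exp ((L + 1) * T) < δ :=
      (continuous_mul_const _).continuousAt.eventually (gt_mem_nhds h0)
    filter_upwards [hsmall.filter_mono nhdsWithin_le_nhds, self_mem_nhdsWithin] with κ hκδ hκ
    have hκ0 : 0 < κ := (norm_nonneg _).trans_lt hκ
    refine image_norm_le_of_norm_deriv_right_lt_deriv_boundary
      (f := fun t => y t - x t) (f' := fun t => F (y t) - F (x t))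
      (B := fun t => κ * Real.exp ((L + 1) * t))
      (B' := fun t => κ * (Real.exp ((L + 1) * t) * (L + 1)))
      (hy.continuousOn.fun_sub hx.continuousOn)
      (fun s hs => (hy.deriv s hs).fun_sub (hx.deriv s hs)) (by simpa using hκ.le)
      (fun s => by simpa using (((hasDerivAt_id s).const_mul (L + 1)).exp).const_mul κ)
      (fun s hs hB => ?_) ht
    have hexp : Real.exp ((L + 1) * s) ≤ Real.exp ((L + 1) * T) := by
      gcongr
      exact hs.2.le
    have hlt : L * ‖y s - x s‖ < (L + 1) * ‖y s - x s‖ := by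
      have : 0 < ‖y s - x s‖ := hB ▸ by positivity
      linarith
    calc ‖F (y s) - F (x s)‖ ≤ L * ‖y s - x s‖ := hF s (Ico_subset_Icc_self hs) _ <|
          hB.le.trans ((mul_le_mul_of_nonneg_left hexp hκ0.le).trans hκδ.le)
      _ < (L + 1) * ‖y s - x s‖ := hlt
      _ = κ * (Real.exp ((L + 1) * s) * (L + 1)) := by rw [hB]; ring
  exact ge_of_tendsto ((continuous_mul_const _).continuousWithinAt.tendsto) hκ

end Solutions

section HolomorphicDependence

open Metric Filter Set

variable {E G : Type*} [NormedAddCommGroup E] [NormedSpace ℂ E] [FiniteDimensional ℂ E]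
  [NormedAddCommGroup G] [NormedSpace ℂ G] [FiniteDimensional ℂ G] {U K : Set E}

theorem exists_forall_norm_sub_sub_fderiv_le {f : E → G} (hU : IsOpen U)
    (hf : DifferentiableOn ℂ f U) (hK : IsCompact K) (hKU : K ⊆ U) {η : ℝ} (hη : 0 < η) :
    ∃ δ > 0, ∀ x ∈ K, ∀ y, ‖y - x‖ ≤ δ → ‖f y - f x - fderiv ℂ f x (y - x)‖ ≤ η * ‖y - x‖ := by
  have := FiniteDimensional.proper ℂ E
  obtain ⟨r, hr, hrU⟩ := hK.exists_cthickening_subset_open hU hKU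
  have hunif := hK.cthickening.uniformContinuousOn_of_continuous
    ((continuousOn_fderiv_of_differentiableOn hU hf).mono hrU)
  obtain ⟨δ, hδ, hfderiv⟩ := Metric.uniformContinuousOn_iff.1 hunif η hη
  refine ⟨min r (δ / 2), by positivity, fun x hx y hy => ?_⟩
  have hmem : ∀ z ∈ closedBall x (min r (δ / 2)), z ∈ cthickening r K := fun z hz =>
    mem_cthickening_of_dist_le z x r K hx (hz.trans (min_le_left _ _))
  have hxmem : x ∈ closedBall x (min r (δ / 2)) := mem_closedBall_self (by positivity)
  refine (convex_closedBall x (min r (δ / 2))).norm_image_sub_le_of_norm_fderiv_le'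
    (𝕜 := ℂ) (fun z hz => hf.differentiableAt (hU.mem_nhds (hrU (hmem z hz))))
    (fun z hz => ?_) hxmem (by rwa [mem_closedBall, dist_eq_norm])
  rw [← dist_eq_norm]
  have hzx : dist z x ≤ δ / 2 := (mem_closedBall.1 hz).trans (min_le_right _ _)
  exact (hfderiv z (hmem z hz) x (hmem x hxmem) (by linarith)).le

theorem exists_forall_norm_sub_le {f : E → G} (hU : IsOpen U) (hf : DifferentiableOn ℂ f U)
    (hK : IsCompact K) (hKU : K ⊆ U) :
    ∃ L ≥ 0, ∃ δ > 0, ∀ x ∈ K, ∀ y, ‖y - x‖ ≤ δ → ‖f y - f x‖ ≤ L * ‖y - x‖ := by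
  obtain ⟨M, hM⟩ := hK.exists_bound_of_continuousOn
    ((continuousOn_fderiv_of_differentiableOn hU hf).mono hKU)
  obtain ⟨δ, hδ, hlin⟩ := exists_forall_norm_sub_sub_fderiv_le hU hf hK hKU one_pos
  refine ⟨max M 0 + 1, by positivity, δ, hδ, fun x hx y hy => ?_⟩
  calc ‖f y - f x‖ ≤ ‖f y - f x - fderiv ℂ f x (y - x)‖ + ‖fderiv ℂ f x (y - x)‖ := by
        simpa using norm_add_le (f y - f x - fderiv ℂ f x (y - x)) (fderiv ℂ f x (y - x))
    _ ≤ 1 * ‖y - x‖ + max M 0 * ‖y - x‖ := add_le_add (hlin x hx y hy)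
        ((fderiv ℂ f x).le_of_opNorm_le ((hM x hx).trans (le_max_left _ _)) _)
    _ = (max M 0 + 1) * ‖y - x‖ := by ring

variable {F : E → E} {T : ℝ} {x y : ℝ → E}

theorem IsSolution.exists_norm_sub_le (hU : IsOpen U) (hF : DifferentiableOn ℂ F U)
    (hx : IsSolution F T x) (hxU : MapsTo x (Icc 0 T) U) :
    ∃ C ≥ 0, ∃ δ > 0, ∀ y, IsSolution F T y → ‖y 0 - x 0‖ < δ →
      ∀ t ∈ Icc 0 T, ‖y t - x t‖ ≤ C * ‖y 0 - x 0‖ := by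
  have hK : IsCompact (x '' Icc 0 T) := isCompact_Icc.image_of_continuousOn hx.continuousOn
  obtain ⟨L, hL, δ, hδ, hlip⟩ := exists_forall_norm_sub_le hU hF hK hxU.image_subset
  refine ⟨Real.exp ((L + 1) * T), by positivity, δ / Real.exp ((L + 1) * T), by positivity,
    fun y hy hy0 t ht => ?_⟩
  rw [lt_div_iff₀ (Real.exp_pos _)] at hy0
  calc ‖y t - x t‖ ≤ ‖y 0 - x 0‖ * Real.exp ((L + 1) * t) :=
        hx.norm_sub_le_mul_exp hy hL (fun s hs => hlip _ (mem_image_of_mem x hs)) hy0 ht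
    _ ≤ ‖y 0 - x 0‖ * Real.exp ((L + 1) * T) := by
        gcongr
        exact ht.2
    _ = Real.exp ((L + 1) * T) * ‖y 0 - x 0‖ := mul_comm _ _

theorem IsSolution.eqOn (hU : IsOpen U) (hF : DifferentiableOn ℂ F U) (hx : IsSolution F T x)
    (hxU : MapsTo x (Icc 0 T) U) (hy : IsSolution F T y) (h0 : y 0 = x 0) :
    EqOn y x (Icc 0 T) := fun t ht => by
  obtain ⟨C, -, δ, hδ, hle⟩ := hx.exists_norm_sub_le hU hF hxU
  have := hle y hy (by simpa [h0] using hδ) t ht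
  rwa [h0, sub_self, norm_zero, mul_zero, norm_le_zero_iff, sub_eq_zero] at this

variable {γ : ℂ → ℝ → E} {v : E}

/-- The difference quotients of the family `γ` solve the variational equation
`q̇ = DF(γ 0 t) q` up to a uniformly small error. -/
theorem eventually_norm_slope_sub_fderiv_le (hU : IsOpen U) (hF : DifferentiableOn ℂ F U)
    (hγ : ∀ᶠ ζ in 𝓝 0, IsSolution F T (γ ζ)) (hv : ∀ᶠ ζ in 𝓝 0, γ ζ 0 = γ 0 0 + ζ • v)
    (hγU : MapsTo (γ 0) (Icc 0 T) U) {η : ℝ} (hη : 0 < η) :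
    ∀ᶠ ζ in 𝓝[≠] 0, ∀ t ∈ Ico 0 T,
      ‖ζ⁻¹ • (F (γ ζ t) - F (γ 0 t)) - fderiv ℂ F (γ 0 t) (ζ⁻¹ • (γ ζ t - γ 0 t))‖ ≤ η := by
  have hx : IsSolution F T (γ 0) := hγ.self_of_nhds
  obtain ⟨C, hC, δ, hδ, hlip⟩ := hx.exists_norm_sub_le hU hF hγU
  obtain ⟨r, hr, hlin⟩ := exists_forall_norm_sub_sub_fderiv_le hU hF
    (isCompact_Icc.image_of_continuousOn hx.continuousOn) hγU.image_subset
    (η := η / (C * ‖v‖ + 1)) (by positivity)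
  have hsmall : ∀ c s : ℝ, 0 < s → ∀ᶠ ζ : ℂ in 𝓝 0, c * ‖ζ • v‖ < s := fun c s hs =>
    (Continuous.tendsto' (by fun_prop) 0 0 (by simp)).eventually (gt_mem_nhds hs)
  refine eventually_nhdsWithin_of_eventually_nhds ?_
  filter_upwards [hγ, hv, hsmall 1 δ hδ, hsmall C r hr] with ζ hζ hζv hζδ hζr t ht
  have ht' := Ico_subset_Icc_self ht
  have hdist : ‖γ ζ t - γ 0 t‖ ≤ C * ‖ζ • v‖ := by
    simpa [hζv] using hlip (γ ζ) hζ (by simpa [hζv] using hζδ) t ht'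
  rw [map_smul, ← smul_sub, norm_smul, norm_inv]
  rcases eq_or_ne ζ 0 with rfl | hζ0
  · simpa using hη.le
  have : 0 < ‖ζ‖ := norm_pos_iff.2 hζ0
  calc ‖ζ‖⁻¹ * ‖F (γ ζ t) - F (γ 0 t) - fderiv ℂ F (γ 0 t) (γ ζ t - γ 0 t)‖
      ≤ ‖ζ‖⁻¹ * (η / (C * ‖v‖ + 1) * (C * ‖ζ • v‖)) := by
        gcongr
        exact (hlin _ (mem_image_of_mem _ ht') _ (hdist.trans hζr.le)).trans (by gcongr)
    _ = η * (C * ‖v‖ / (C * ‖v‖ + 1)) := by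
        rw [norm_smul]
        field_simp
    _ ≤ η := mul_le_of_le_one_right hη.le (div_le_one_of_le₀ (by linarith) (by positivity))

theorem eventually_dist_slope_slope_le (hU : IsOpen U) (hF : DifferentiableOn ℂ F U)
    (hγ : ∀ᶠ ζ in 𝓝 0, IsSolution F T (γ ζ)) (hv : ∀ᶠ ζ in 𝓝 0, γ ζ 0 = γ 0 0 + ζ • v)
    (hγU : MapsTo (γ 0) (Icc 0 T) U) (hT : 0 ≤ T) {ε : ℝ} (hε : 0 < ε) :
    ∃ s ∈ 𝓝[≠] (0 : ℂ), ∀ ζ ∈ s, ∀ ξ ∈ s,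
      dist (ζ⁻¹ • (γ ζ T - γ 0 T)) (ξ⁻¹ • (γ ξ T - γ 0 T)) < ε := by
  have hx : IsSolution F T (γ 0) := hγ.self_of_nhds
  obtain ⟨M, hM⟩ := isCompact_Icc.exists_bound_of_continuousOn
    ((continuousOn_fderiv_of_differentiableOn hU hF).comp hx.continuousOn hγU)
  have hlipschitz : ∀ t ∈ Ico 0 T,
      LipschitzOnWith M.toNNReal (fderiv ℂ F (γ 0 t)) univ := fun t ht =>
    ((fderiv ℂ F (γ 0 t)).lipschitz.weaken (NNReal.coe_le_coe.1 <|
      (hM t (Ico_subset_Icc_self ht)).trans (Real.le_coe_toNNReal M))).lipschitzOnWith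
  have hbound : ∀ᶠ e in 𝓝 (0 : ℝ), gronwallBound 0 M.toNNReal (e + e) T < ε := by
    have hcont : Continuous fun e : ℝ => gronwallBound 0 M.toNNReal (e + e) T :=
      (gronwallBound_continuous_ε _ _ _).comp (continuous_id.add continuous_id)
    exact (hcont.tendsto' 0 0 (by simp [gronwallBound_ε0_δ0])).eventually (gt_mem_nhds hε)
  obtain ⟨e, he, he0⟩ :=
    ((hbound.filter_mono nhdsWithin_le_nhds).and (self_mem_nhdsWithin (s := Ioi 0))).exists
  have hslope : ∀ ζ : ℂ, IsSolution F T (γ ζ) → ContinuousOn (fun t => ζ⁻¹ • (γ ζ t - γ 0 t))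
      (Icc 0 T) ∧ ∀ t ∈ Ico 0 T, HasDerivWithinAt (fun t => ζ⁻¹ • (γ ζ t - γ 0 t))
        (ζ⁻¹ • (F (γ ζ t) - F (γ 0 t))) (Ici t) t := fun ζ hζ =>
    ⟨(hζ.continuousOn.fun_sub hx.continuousOn).fun_const_smul _, fun t ht =>
      ((hζ.deriv t ht).fun_sub (hx.deriv t ht)).fun_const_smul _⟩
  have hinit : ∀ ζ : ℂ, ζ ≠ 0 → γ ζ 0 = γ 0 0 + ζ • v → ζ⁻¹ • (γ ζ 0 - γ 0 0) = v :=
    fun ζ hζ h => by rw [h, add_sub_cancel_left, inv_smul_smul₀ hζ]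
  refine ⟨_, (hγ.filter_mono nhdsWithin_le_nhds).and ((hv.filter_mono nhdsWithin_le_nhds).and
    ((eventually_norm_slope_sub_fderiv_le hU hF hγ hv hγU he0).and self_mem_nhdsWithin)), ?_⟩
  rintro ζ ⟨hζ, hζv, hζe, hζ0⟩ ξ ⟨hξ, hξv, hξe, hξ0⟩
  have hdist := dist_le_of_approx_trajectories_ODE_of_mem (δ := 0) hlipschitz
    (hslope ζ hζ).1 (hslope ζ hζ).2 (fun t ht => (dist_eq_norm _ _).trans_le (hζe t ht))
    (fun _ _ => mem_univ _) (hslope ξ hξ).1 (hslope ξ hξ).2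
    (fun t ht => (dist_eq_norm _ _).trans_le (hξe t ht)) (fun _ _ => mem_univ _)
    (by rw [hinit ζ hζ0 hζv, hinit ξ hξ0 hξv, dist_self]) T (right_mem_Icc.2 hT)
  exact hdist.trans_lt (by rwa [sub_zero])

theorem differentiableAt_of_isSolution (hU : IsOpen U) (hF : DifferentiableOn ℂ F U)
    (hγ : ∀ᶠ ζ in 𝓝 0, IsSolution F T (γ ζ)) (hv : ∀ᶠ ζ in 𝓝 0, γ ζ 0 = γ 0 0 + ζ • v)
    (hγU : MapsTo (γ 0) (Icc 0 T) U) (hT : 0 ≤ T) :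
    DifferentiableAt ℂ (fun ζ => γ ζ T) 0 := by
  have := FiniteDimensional.complete ℂ E
  have hcauchy : Cauchy (map (fun ζ => ζ⁻¹ • (γ ζ T - γ 0 T)) (𝓝[≠] (0 : ℂ))) := by
    refine Metric.cauchy_iff.2 ⟨inferInstance, fun ε hε => ?_⟩
    obtain ⟨s, hs, hdist⟩ := eventually_dist_slope_slope_le hU hF hγ hv hγU hT hε
    exact ⟨_, image_mem_map hs, forall_mem_image.2 fun ζ hζ =>
      forall_mem_image.2 fun ξ hξ => hdist ζ hζ ξ hξ⟩
  obtain ⟨A, hA⟩ := cauchy_map_iff_exists_tendsto.1 hcauchy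
  have hderiv : HasDerivAt (fun ζ => γ ζ T) A 0 := by
    simpa [hasDerivAt_iff_tendsto_slope_zero] using hA
  exact hderiv.differentiableAt

end HolomorphicDependence

section ForwardFlow

open Metric Filter Set

variable {n : ℕ} {ρ : ℝ}

theorem polydisk_eq_ball (hρ : 0 < ρ) : polydisk n ρ = ball 0 ρ := by
  ext z
  simp [polydisk, pi_norm_lt_iff hρ]

theorem zero_mem_polydisk (hρ : 0 < ρ) : 0 ∈ polydisk n ρ := by
  simp [polydisk, hρ]

theorem polydisk_subset_polydisk {r : ℝ} (h : r ≤ ρ) : polydisk n r ⊆ polydisk n ρ :=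
  fun _ hz l => (hz l).trans_le h

theorem isOpen_polydisk (ρ : ℝ) : IsOpen (polydisk n ρ) := by
  simp only [polydisk, ofPred_forall]
  exact isOpen_iInter_of_finite fun l => isOpen_lt (by fun_prop) continuous_const

variable {X : Set (Fin n → ℂ)} {F : (Fin n → ℂ) → (Fin n → ℂ)}
  {φ : ℝ → (Fin n → ℂ) → (Fin n → ℂ)}

namespace IsForwardFlow

theorem isSolution (hφ : IsForwardFlow X F φ) {z : Fin n → ℂ} (hz : z ∈ X) (T : ℝ) :
    IsSolution F T (fun t => φ t z) where
  continuousOn t ht := (hφ.deriv z hz t ht.1).continuousWithinAt.mono Icc_subset_Ici_self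
  deriv t ht := (hφ.deriv z hz t ht.1).mono (Ici_subset_Ici.2 ht.1)

variable (hX : IsOpen X) (hF : DifferentiableOn ℂ F X) (hφ : IsForwardFlow X F φ)
include hX hF hφ

theorem eqOn {T : ℝ} {y : ℝ → (Fin n → ℂ)} (hy : IsSolution F T y) (h0 : y 0 ∈ X) :
    EqOn y (fun t => φ t (y 0)) (Icc 0 T) :=
  (hφ.isSolution h0 T).eqOn hX hF (fun t ht => hφ.mapsTo t ht.1 h0) hy (hφ.zero _ h0).symm

theorem apply_zero (h0X : 0 ∈ X) (hF0 : F 0 = 0) {t : ℝ} (ht : 0 ≤ t) : φ t 0 = 0 :=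
  (hφ.eqOn hX hF (y := fun _ => 0) ⟨continuousOn_const, fun s _ => by
    simpa [hF0] using hasDerivWithinAt_const s (Ici s) (0 : Fin n → ℂ)⟩ h0X
    (right_mem_Icc.2 ht)).symm

theorem differentiableAt_comp_smul {t : ℝ} (ht : 0 ≤ t) {z : Fin n → ℂ} {ζ₀ : ℂ}
    (hz : ζ₀ • z ∈ X) : DifferentiableAt ℂ (fun ζ : ℂ => φ t (ζ • z)) ζ₀ := by
  have hnear : ∀ᶠ ζ : ℂ in 𝓝 0, (ζ₀ + ζ) • z ∈ X :=
    (Continuous.tendsto' (by fun_prop) 0 (ζ₀ • z) (by simp)).eventually (hX.mem_nhds hz)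
  have hshift : DifferentiableAt ℂ (fun ζ : ℂ => φ t ((ζ₀ + ζ) • z)) 0 :=
    differentiableAt_of_isSolution hX hF (γ := fun ζ s => φ s ((ζ₀ + ζ) • z)) (v := z)
      (hnear.mono fun ζ hζ => hφ.isSolution hζ t)
      (hnear.mono fun ζ hζ => by
        rw [hφ.zero _ hζ, hφ.zero _ hnear.self_of_nhds, add_zero, add_smul])
      (fun s hs => hφ.mapsTo s hs.1 hnear.self_of_nhds) ht
  have hcomp := DifferentiableAt.comp ζ₀ (f := fun ζ : ℂ => ζ - ζ₀)
    (by rwa [sub_self]) (differentiableAt_id.sub_const ζ₀)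
  simpa only [Function.comp_def, add_sub_cancel] using hcomp

end IsForwardFlow

theorem IsForwardFlow.norm_le (hF : DifferentiableOn ℂ F (polydisk n 1))
    (hφ : IsForwardFlow (polydisk n 1) F φ) (hF0 : F 0 = 0) (hρ : ρ ≤ 1)
    (hinv : ∀ t, 0 ≤ t → MapsTo (φ t) (polydisk n ρ) (polydisk n ρ)) {z : Fin n → ℂ}
    (hz : ‖z‖ < ρ) {t : ℝ} (ht : 0 ≤ t) : ‖φ t z‖ ≤ ‖z‖ := by
  have hX : IsOpen (polydisk n 1) := isOpen_polydisk 1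
  have hball : polydisk n ρ = ball 0 ρ := polydisk_eq_ball ((norm_nonneg z).trans_lt hz)
  have hsub : ball (0 : Fin n → ℂ) ρ ⊆ polydisk n 1 := hball ▸ polydisk_subset_polydisk hρ
  rw [hball] at hinv
  have hzero : φ t 0 = 0 := hφ.apply_zero hX hF (zero_mem_polydisk one_pos) hF0 ht
  rcases eq_or_ne z 0 with rfl | hz0
  · rw [hzero]
  have hzpos : 0 < ‖z‖ := norm_pos_iff.2 hz0
  have hmem : ∀ ζ ∈ ball (0 : ℂ) (ρ / ‖z‖), ζ • z ∈ ball (0 : Fin n → ℂ) ρ := fun ζ hζ => by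
    rw [mem_ball_zero_iff] at hζ ⊢
    rwa [norm_smul, ← lt_div_iff₀ hzpos]
  have hschwarz := Complex.dist_le_div_mul_dist_of_mapsTo_ball (R₂ := ρ) (z := 1)
    (f := fun ζ : ℂ => φ t (ζ • z)) (c := 0) (R₁ := ρ / ‖z‖)
    (fun ζ hζ => (hφ.differentiableAt_comp_smul hX hF ht
      (hsub (hmem ζ hζ))).differentiableWithinAt)
    (fun ζ hζ => by
      simp only [zero_smul, hzero]
      exact ball_subset_closedBall (hinv t ht (hmem ζ hζ)))
    (by rwa [mem_ball_zero_iff, norm_one, one_lt_div hzpos])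
  simp only [zero_smul, hzero, one_smul, dist_zero_right, norm_one, mul_one] at hschwarz
  rwa [div_div_cancel₀ (hzpos.trans hz).ne'] at hschwarz

end ForwardFlow

section Triangularization

open Module

variable {K : Type*} [Field K] [IsAlgClosed K] [CharZero K]

theorem exists_lieSubmodule_finrank_eq_one (L V : Type*) [LieRing L] [LieAlgebra K L]
    [LieAlgebra.IsSolvable L] [AddCommGroup V] [Module K V] [FiniteDimensional K V] [Nontrivial V]
    [LieRingModule L V] [LieModule K L V] : ∃ N : LieSubmodule K L V, finrank K N = 1 := by
  obtain ⟨χ, hχ⟩ := LieModule.exists_nontrivial_weightSpace_of_isSolvable K L V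
  obtain ⟨⟨v, hv⟩, hv0⟩ := exists_ne (0 : LieModule.weightSpace V χ)
  rw [LieModule.mem_weightSpace] at hv
  refine ⟨{ K ∙ v with lie_mem := fun {x m} hm => ?_ },
    finrank_span_singleton fun h => hv0 (Subtype.ext h)⟩
  obtain ⟨c, rfl⟩ := Submodule.mem_span_singleton.1 hm
  rw [lie_smul, hv]
  exact Submodule.smul_mem _ _ (Submodule.smul_mem _ _ (Submodule.mem_span_singleton_self v))

theorem exists_basis_repr_lie_eq_zero {L : Type*} [LieRing L] [LieAlgebra K L]
    [LieAlgebra.IsSolvable L] {n : ℕ} (V : Type*) [AddCommGroup V] [Module K V]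
    [FiniteDimensional K V] [LieRingModule L V] [LieModule K L V] (hn : finrank K V = n) :
    ∃ b : Basis (Fin n) K V, ∀ (x : L) (i j : Fin n), j < i → b.repr ⁅x, b j⁆ i = 0 := by
  induction n generalizing V with
  | zero => exact ⟨finBasisOfFinrankEq K V hn, fun x i => i.elim0⟩
  | succ n ih =>
    have : Nontrivial V := nontrivial_of_finrank_pos (R := K) (by omega)
    obtain ⟨N, hN⟩ := exists_lieSubmodule_finrank_eq_one (K := K) L V
    have hquot : finrank K (V ⧸ N) + finrank K N = finrank K V :=
      N.toSubmodule.finrank_quotient_add_finrank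
    have : FiniteDimensional K (V ⧸ N) := inferInstanceAs (FiniteDimensional K (V ⧸ N.toSubmodule))
    obtain ⟨c, hc⟩ := ih (V ⧸ N) (by omega)
    let b := Basis.sumQuot (W := N.toSubmodule) (finBasisOfFinrankEq K N hN) c
    let e : Fin 1 ⊕ Fin n ≃ Fin (n + 1) := finSumFinEquiv.trans (finCongr (add_comm 1 n))
    refine ⟨b.reindex e, fun x i j hij => ?_⟩
    obtain ⟨i, rfl⟩ := e.surjective i
    obtain ⟨j, rfl⟩ := e.surjective j
    rw [Basis.repr_reindex_apply, Basis.reindex_apply, e.symm_apply_apply, e.symm_apply_apply]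
    rcases i with i | i
    · rcases j with j | j <;> simp [e, Fin.lt_def] at hij
    rcases j with j | j
    · refine Basis.sumQuot_repr_inr_of_mem _ _ _ (N.lie_mem ?_) i
      rw [Basis.sumQuot_inl]
      exact (finBasisOfFinrankEq K N hN j).2
    · have hlie : N.toSubmodule.mkQ ⁅x, b (Sum.inr j)⁆ = ⁅x, c j⁆ :=
        congrArg (fun y : V ⧸ N => ⁅x, y⁆) (Basis.sumQuot_inr _ c j)
      rw [Basis.sumQuot_repr_inr, hlie]
      exact hc x i j (by
        change 1 + (j : ℕ) < 1 + i at hij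
        omega)

attribute [local instance] LieRing.ofAssociativeRing

variable {n m : ℕ}

theorem exists_isUnit_blockTriangular {S : Set (Matrix (Fin n) (Fin n) K)}
    [LieAlgebra.IsSolvable (LieSubalgebra.lieSpan K (Matrix (Fin n) (Fin n) K) S)] :
    ∃ P : Matrix (Fin n) (Fin n) K, IsUnit P ∧ ∀ A ∈ S, (P⁻¹ * A * P).BlockTriangular id := by
  let L := LieSubalgebra.lieSpan K (Matrix (Fin n) (Fin n) K) S
  obtain ⟨b, hb⟩ := exists_basis_repr_lie_eq_zero (L := L) (Fin n → K) (finrank_fin_fun K)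
  let e := Pi.basisFun K (Fin n)
  have hinv : (e.toMatrix b)⁻¹ = b.toMatrix e :=
    Matrix.inv_eq_left_inv (b.toMatrix_mul_toMatrix_flip e)
  refine ⟨e.toMatrix b, .of_mul_eq_one _ (e.toMatrix_mul_toMatrix_flip b), fun A hA => ?_⟩
  have hconj : (e.toMatrix b)⁻¹ * A * e.toMatrix b
      = LinearMap.toMatrix b b (Matrix.toLin' A) := by
    rw [hinv, ← basis_toMatrix_mul_linearMap_toMatrix_mul_basis_toMatrix (b' := e) (c' := e)]
    simp [e, LinearMap.toMatrix_eq_toMatrix']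
  intro k l hlk
  rw [hconj, LinearMap.toMatrix_apply]
  simpa using hb ⟨A, LieSubalgebra.subset_lieSpan hA⟩ k l hlk

open scoped Matrix.Norms.Operator in
theorem exists_isNormalizedTriangularizer [NeZero n] {A : Fin m → Matrix (Fin n) (Fin n) ℂ}
    (hA : GeneratesSolvable A) : ∃ P, IsNormalizedTriangularizer A P := by
  have : LieAlgebra.IsSolvable
    (LieSubalgebra.lieSpan ℂ (Matrix (Fin n) (Fin n) ℂ) (Set.range A)) := hA
  obtain ⟨P, hP, htri⟩ := exists_isUnit_blockTriangular (S := Set.range A)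
  have hdet : IsUnit P.det := (Matrix.isUnit_iff_isUnit_det P).1 hP
  have hnorm : ‖P⁻¹‖ ≠ 0 := fun h => zero_ne_one (α := Matrix (Fin n) (Fin n) ℂ) <| by
    rw [← P.nonsing_inv_mul hdet, norm_eq_zero.1 h, zero_mul]
  have hc : (‖P⁻¹‖ : ℂ) ≠ 0 := by exact_mod_cast hnorm
  have hinv : ((‖P⁻¹‖ : ℂ) • P)⁻¹ = (‖P⁻¹‖ : ℂ)⁻¹ • P⁻¹ := Matrix.inv_eq_left_inv <| by
    rw [smul_mul_smul_comm, P.nonsing_inv_mul hdet, inv_mul_cancel₀ hc, one_smul]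
  refine ⟨(‖P⁻¹‖ : ℂ) • P, ?_, ?_, fun i => ?_⟩
  · rw [Matrix.isUnit_iff_isUnit_det, Matrix.det_smul]
    exact ((isUnit_iff_ne_zero.2 hc).pow _).mul hdet
  · rw [hinv, infNorm, norm_smul, norm_inv, Complex.norm_real, norm_norm, inv_mul_cancel₀ hnorm]
  · rw [hinv, smul_mul_assoc, smul_mul_smul_comm, inv_mul_cancel₀ hc, one_smul]
    exact htri _ (Set.mem_range_self i)

end Triangularization

section DoubleSeries

section Substochastic

variable {ι κ : Type*} {b : ι → κ → ℝ} {u : ι → ℝ}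

theorem summable_prod_mul_of_tsum_le_one (hb : ∀ i k, 0 ≤ b i k) (hbs : ∀ i, Summable (b i))
    (hb1 : ∀ i, ∑' k, b i k ≤ 1) (hu0 : ∀ i, 0 ≤ u i) (hu : Summable u) :
    Summable fun p : ι × κ => b p.1 p.2 * u p.1 := by
  rw [summable_prod_of_nonneg fun p => mul_nonneg (hb p.1 p.2) (hu0 p.1)]
  refine ⟨fun i => (hbs i).mul_right (u i), ?_⟩
  simp only [tsum_mul_right]
  exact .of_nonneg_of_le (fun i => mul_nonneg (tsum_nonneg (hb i)) (hu0 i))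
    (fun i => mul_le_of_le_one_left (hu0 i) (hb1 i)) hu

theorem tsum_prod_mul_le_of_tsum_le_one (hb : ∀ i k, 0 ≤ b i k) (hbs : ∀ i, Summable (b i))
    (hb1 : ∀ i, ∑' k, b i k ≤ 1) (hu0 : ∀ i, 0 ≤ u i) (hu : Summable u) :
    ∑' p : ι × κ, b p.1 p.2 * u p.1 ≤ ∑' i, u i := by
  have h := summable_prod_mul_of_tsum_le_one hb hbs hb1 hu0 hu
  rw [h.tsum_prod]
  refine Summable.tsum_le_tsum (fun i => ?_) h.prod hu
  exact tsum_mul_right.trans_le (mul_le_of_le_one_left (hu0 i) (hb1 i))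

end Substochastic

theorem hasSum_ite_diag {ι α : Type*} [DecidableEq ι] [AddCommMonoid α] [TopologicalSpace α]
    {f : ι → α} {s : α} (hf : HasSum f s) :
    HasSum (fun p : ι × ι => if p.1 = p.2 then f p.1 else 0) s := by
  have hinj : Function.Injective fun i : ι => (i, i) := fun _ _ h => congrArg Prod.fst h
  rw [← hinj.hasSum_iff fun p hp => if_neg fun h => hp ⟨p.1, Prod.ext rfl h⟩]
  simpa [Function.comp_def] using hf

theorem abs_re_conj_mul_mul_le (x y z : ℂ) :
    |((starRingEnd ℂ) x * (y * z)).re| ≤ ‖x‖ * ‖y‖ * ‖z‖ :=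
  (Complex.abs_re_le_norm _).trans_eq <| by rw [norm_mul, norm_mul, Complex.norm_conj, mul_assoc]

/-- Weighted AM-GM; the quantities `Q_{jk}` enter in this shape. -/
theorem two_mul_le_of_crossRatio_lt {a p q β β' x y e e' : ℝ} (hp : 0 < p) (hq : 0 < q)
    (hβ : 0 ≤ β) (hβ' : 0 ≤ β') (hββ' : 0 < β * β') (he : 0 < e) (he' : 0 < e')
    (h : e * (a ^ 2 / (4 * p * q) * (1 / (β * β'))) < e') :
    2 * (e * (x * a * y)) ≤ β * (2 * p * e' * y ^ 2) + β' * (2 * q * e * x ^ 2) := by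
  have hea : e * a ^ 2 < e' * (4 * p * q * (β * β')) := by
    rwa [div_mul_div_comm, mul_one, mul_div_assoc', div_lt_iff₀ (by positivity)] at h
  refine le_of_sq_le_sq ?_ (by positivity)
  have hxy : e * (e * a ^ 2) * (x * y) ^ 2 ≤ e * (e' * (4 * p * q * (β * β'))) * (x * y) ^ 2 := by
    gcongr
  nlinarith [sq_nonneg (β * (2 * p * e' * y ^ 2) - β' * (2 * q * e * x ^ 2))]

/-- The hypotheses of the theorem on the lower triangular Koopman matrix `A k j = ⟨L e_k, e_j⟩` of
one subsystem, the weights `b` and the coefficients `ε` of the Lyapunov function. Indices start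
at `0` here, so that `k` stands for the multi-index `α(k + 1)`. -/
structure IsDominated (ε : ℕ → ℝ) (A : ℕ → ℕ → ℂ) (b : ℕ → ℕ → ℝ) : Prop where
  eps_pos : ∀ j, 0 < ε j
  triangular : ∀ k j, j < k → A k j = 0
  diag_neg : ∀ k, (A k k).re < 0
  nonneg : ∀ j k, 0 ≤ b j k
  pos : ∀ j k, A k j ≠ 0 → 0 < b j k * b k j
  summable : ∀ j, Summable (b j)
  tsum_le : ∀ j, ∑' k, b j k ≤ 1
  lt : ∀ k j, k < j → A k j ≠ 0 → ε k * (‖A k j‖ ^ 2 / (4 * |(A j j).re| * |(A k k).re|)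
      * (1 / (b j k * b k j))) < ε j

/-- The rate at which the term `ε_j |v_j|²` of the Lyapunov function decreases under the diagonal
part of the matrix `A`. -/
noncomputable def dissipation (ε : ℕ → ℝ) (A : ℕ → ℕ → ℂ) (v : ℕ → ℂ) (j : ℕ) : ℝ :=
  2 * |(A j j).re| * ε j * ‖v j‖ ^ 2

namespace IsDominated

variable {ε : ℕ → ℝ} {A : ℕ → ℕ → ℂ} {b : ℕ → ℕ → ℝ} {v : ℕ → ℂ} (h : IsDominated ε A b)
include h

theorem dissipation_nonneg (j : ℕ) : 0 ≤ dissipation ε A v j := by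
  have := h.eps_pos j
  unfold dissipation
  positivity

theorem dissipation_pos {j : ℕ} (hv : v j ≠ 0) : 0 < dissipation ε A v j := by
  have hε := h.eps_pos j
  have hA := (h.diag_neg j).ne
  unfold dissipation
  positivity

theorem weight_diag_pos (j : ℕ) : 0 < b j j := by
  have hA : A j j ≠ 0 := fun h0 => (h.diag_neg j).ne (by rw [h0, Complex.zero_re])
  exact (h.nonneg j j).lt_of_ne' fun h0 => (h.pos j j hA).ne' (by rw [h0, mul_zero])

theorem two_mul_offDiag_le {k j : ℕ} (hkj : k < j) :
    2 * (ε k * (‖v k‖ * ‖A k j‖ * ‖v j‖))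
      ≤ b j k * dissipation ε A v j + b k j * dissipation ε A v k := by
  by_cases hA : A k j = 0
  · rw [hA, norm_zero, mul_zero, zero_mul, mul_zero, mul_zero]
    exact add_nonneg (mul_nonneg (h.nonneg j k) (h.dissipation_nonneg j))
      (mul_nonneg (h.nonneg k j) (h.dissipation_nonneg k))
  · exact two_mul_le_of_crossRatio_lt (abs_pos.2 (h.diag_neg j).ne) (abs_pos.2 (h.diag_neg k).ne)
      (h.nonneg _ _) (h.nonneg _ _) (h.pos _ _ hA) (h.eps_pos k) (h.eps_pos j) (h.lt k j hkj hA)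

theorem summable_dissipation (hs : Summable fun j => ‖A j j‖ * (ε j * ‖v j‖ ^ 2)) :
    Summable (dissipation ε A v) := by
  refine .of_nonneg_of_le h.dissipation_nonneg (fun j => ?_) (hs.mul_left 2)
  have hε := h.eps_pos j
  have hA := Complex.abs_re_le_norm (A j j)
  calc dissipation ε A v j = 2 * (|(A j j).re| * (ε j * ‖v j‖ ^ 2)) := by
        rw [dissipation]; ring
    _ ≤ 2 * (‖A j j‖ * (ε j * ‖v j‖ ^ 2)) := by gcongr

theorem summable_weight_mul_dissipation (hs : Summable fun j => ‖A j j‖ * (ε j * ‖v j‖ ^ 2)) :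
    Summable fun p : ℕ × ℕ => b p.1 p.2 * dissipation ε A v p.1 :=
  summable_prod_mul_of_tsum_le_one h.nonneg h.summable h.tsum_le h.dissipation_nonneg
    (h.summable_dissipation hs)

theorem summable_eps_mul_norm (hs : Summable fun j => ‖A j j‖ * (ε j * ‖v j‖ ^ 2)) :
    Summable fun p : ℕ × ℕ => ε p.1 * (‖v p.1‖ * ‖A p.1 p.2‖ * ‖v p.2‖) := by
  have hW := h.summable_weight_mul_dissipation hs
  refine .of_nonneg_of_le (fun p => ?_) (fun ⟨k, j⟩ => ?_)
    ((hW.add ((Equiv.prodComm ℕ ℕ).summable_iff.2 hW)).add (hasSum_ite_diag hs.hasSum).summable)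
  · have := h.eps_pos p.1
    positivity
  have hkj := mul_nonneg (h.nonneg k j) (h.dissipation_nonneg (v := v) k)
  have hjk := mul_nonneg (h.nonneg j k) (h.dissipation_nonneg (v := v) j)
  simp only [Function.comp_apply, Equiv.prodComm_apply, Prod.fst_swap, Prod.snd_swap]
  rcases lt_trichotomy k j with hlt | rfl | hlt
  · have hε := h.eps_pos k
    have : 0 ≤ ε k * (‖v k‖ * ‖A k j‖ * ‖v j‖) := by positivity
    rw [if_neg hlt.ne]
    linarith [h.two_mul_offDiag_le (v := v) hlt]
  · rw [if_pos rfl, show ε k * (‖v k‖ * ‖A k k‖ * ‖v k‖) = ‖A k k‖ * (ε k * ‖v k‖ ^ 2) by ring]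
    linarith
  · rw [if_neg hlt.ne', h.triangular k j hlt, norm_zero, mul_zero, zero_mul, mul_zero]
    linarith

theorem summable_re (hs : Summable fun j => ‖A j j‖ * (ε j * ‖v j‖ ^ 2)) :
    Summable fun p : ℕ × ℕ =>
      2 * (ε p.1 * ((starRingEnd ℂ) (v p.1) * (A p.1 p.2 * v p.2)).re) := by
  refine .of_norm_bounded ((h.summable_eps_mul_norm hs).mul_left 2) fun p => ?_
  rw [norm_mul, norm_mul, Real.norm_two, Real.norm_of_nonneg (h.eps_pos p.1).le]
  gcongr
  · exact (h.eps_pos p.1).le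
  · exact abs_re_conj_mul_mul_le (v p.1) (A p.1 p.2) (v p.2)

theorem two_mul_re_diag (k : ℕ) :
    2 * (ε k * ((starRingEnd ℂ) (v k) * (A k k * v k)).re) = -dissipation ε A v k := by
  have hmul : (starRingEnd ℂ) (v k) * (A k k * v k) = A k k * (‖v k‖ ^ 2 : ℝ) := by
    rw [← Complex.normSq_eq_norm_sq, Complex.normSq_eq_conj_mul_self]
    ring
  rw [hmul, Complex.re_mul_ofReal, dissipation, abs_of_neg (h.diag_neg k)]
  ring

theorem two_mul_re_le_of_lt {k j : ℕ} (hkj : k < j) :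
    2 * (ε k * ((starRingEnd ℂ) (v k) * (A k j * v j)).re)
      ≤ b k j * dissipation ε A v k + b j k * dissipation ε A v j := by
  have hre := (le_abs_self _).trans (abs_re_conj_mul_mul_le (v k) (A k j) (v j))
  linarith [mul_le_mul_of_nonneg_left hre (h.eps_pos k).le, h.two_mul_offDiag_le (v := v) hkj]

theorem re_add_re_swap_le (k j : ℕ) :
    2 * (ε k * ((starRingEnd ℂ) (v k) * (A k j * v j)).re)
        + 2 * (ε j * ((starRingEnd ℂ) (v j) * (A j k * v k)).re)
      ≤ b k j * dissipation ε A v k + b j k * dissipation ε A v j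
        - 2 * if k = j then dissipation ε A v k + b k k * dissipation ε A v k else 0 := by
  rcases lt_trichotomy k j with hlt | rfl | hlt
  · have hle := h.two_mul_re_le_of_lt (v := v) hlt
    simpa [h.triangular j k hlt, hlt.ne] using hle
  · rw [if_pos rfl, h.two_mul_re_diag]
    exact le_of_eq (by ring)
  · have hle := h.two_mul_re_le_of_lt (v := v) hlt
    simpa [h.triangular k j hlt, hlt.ne', add_comm] using hle

/-- Adding the `(k, j)` and `(j, k)` entries, the off-diagonal terms are absorbed by the dissipation
because each row of `b` sums to at most `1`; what is left over is `-∑ b k k * dissipation k`. -/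
theorem tsum_re_neg (hs : Summable fun j => ‖A j j‖ * (ε j * ‖v j‖ ^ 2)) {j₀ : ℕ} (hv : v j₀ ≠ 0) :
    ∑' p : ℕ × ℕ, 2 * (ε p.1 * ((starRingEnd ℂ) (v p.1) * (A p.1 p.2 * v p.2)).re) < 0 := by
  have hu := h.summable_dissipation hs
  have hW := h.summable_weight_mul_dissipation hs
  have hWle : ∑' p : ℕ × ℕ, b p.1 p.2 * dissipation ε A v p.1 ≤ ∑' j, dissipation ε A v j :=
    tsum_prod_mul_le_of_tsum_le_one h.nonneg h.summable h.tsum_le h.dissipation_nonneg hu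
  have hWdiag : Summable fun k => b k k * dissipation ε A v k :=
    hW.comp_injective (i := fun k : ℕ => (k, k)) fun _ _ hkj => congrArg Prod.fst hkj
  have hWpos : 0 < ∑' k, b k k * dissipation ε A v k :=
    hWdiag.tsum_pos (fun k => mul_nonneg (h.nonneg k k) (h.dissipation_nonneg k)) j₀
      (mul_pos (h.weight_diag_pos j₀) (h.dissipation_pos hv))
  have hT := h.summable_re hs
  have hle := hasSum_le (fun p : ℕ × ℕ => h.re_add_re_swap_le (v := v) p.1 p.2)
    (hT.hasSum.add ((Equiv.prodComm ℕ ℕ).hasSum_iff.2 hT.hasSum))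
    ((hW.hasSum.add ((Equiv.prodComm ℕ ℕ).hasSum_iff.2 hW.hasSum)).sub
      ((hasSum_ite_diag (hu.hasSum.add hWdiag.hasSum)).mul_left 2))
  linarith

end IsDominated

end DoubleSeries

section Expansion

open Metric Finset

/-- The identity theorem gives equality in the part of the unit disk inside `V`, and both sides are
continuous at the boundary point `1`. -/
theorem hasSum_apply_one_of_eventually_hasSum {E : Type*} [NormedAddCommGroup E] [NormedSpace ℂ E]
    [CompleteSpace E] {V : Set ℂ} (hV : IsOpen V) (hVc : Convex ℝ V) (h0 : 0 ∈ V) (h1 : 1 ∈ V)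
    {g : ℂ → E} (hg : DifferentiableOn ℂ g V) {a : ℕ → E} (ha : Summable fun d => ‖a d‖)
    (hev : ∀ᶠ ζ in 𝓝 0, HasSum (fun d => ζ ^ d • a d) (g ζ)) : HasSum a (g 1) := by
  let G : ℂ → E := fun ζ => ∑' d, ζ ^ d • a d
  have hle : ∀ (d : ℕ), ∀ ζ ∈ closedBall (0 : ℂ) 1, ‖ζ ^ d • a d‖ ≤ ‖a d‖ := fun d ζ hζ => by
    rw [norm_smul, norm_pow]
    exact mul_le_of_le_one_left (norm_nonneg _)
      (pow_le_one₀ (norm_nonneg _) (mem_closedBall_zero_iff.1 hζ))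
  have hGd : DifferentiableOn ℂ G (ball 0 1) := Complex.differentiableOn_tsum_of_summable_norm ha
    (fun d => by fun_prop) isOpen_ball fun d ζ hζ => hle d ζ (ball_subset_closedBall hζ)
  have hGc : ContinuousOn G (closedBall 0 1) := continuousOn_tsum (fun d => by fun_prop) ha hle
  have hVb : IsOpen (V ∩ ball (0 : ℂ) 1) := hV.inter isOpen_ball
  have heq : Set.EqOn g G (V ∩ ball 0 1) :=
    ((hg.mono Set.inter_subset_left).analyticOnNhd hVb).eqOn_of_preconnected_of_eventuallyEq
      ((hGd.mono Set.inter_subset_right).analyticOnNhd hVb)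
      (hVc.inter (convex_ball 0 1)).isPreconnected ⟨h0, mem_ball_self one_pos⟩
      (hev.mono fun ζ hζ => hζ.tsum_eq.symm)
  have h1mem : (1 : ℂ) ∈ closedBall 0 1 := by simp
  have : (𝓝[V ∩ ball (0 : ℂ) 1] 1).NeBot := mem_closure_iff_nhdsWithin_neBot.1 <|
    hV.inter_closure ⟨h1, by rwa [closure_ball _ one_ne_zero]⟩
  have hG1 : G 1 = g 1 := tendsto_nhds_unique_of_eventuallyEq
    ((hGc 1 h1mem).mono (Set.inter_subset_right.trans ball_subset_closedBall))
    ((hg.continuousOn 1 h1).mono Set.inter_subset_left)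
    (eventually_mem_nhdsWithin.mono fun ζ hζ => (heq hζ).symm)
  rw [← hG1]
  simpa [G] using ha.of_norm.hasSum

variable {n : ℕ}

theorem hasSum_sum_piAntidiag {E : Type*} [NormedAddCommGroup E] [CompleteSpace E]
    {f : (Fin n → ℕ) → E} {a : E} (hf : HasSum f a) :
    HasSum (fun d => ∑ β ∈ piAntidiag univ d, f β) a := by
  refine (hf.tsum_fiberwise degree).congr_fun fun d => ?_
  have hfiber : (degree : (Fin n → ℕ) → ℕ) ⁻¹' {d} = (piAntidiag univ d : Finset (Fin n → ℕ)) :=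
    Set.ext fun β => by simp only [Set.mem_preimage, Set.mem_singleton_iff, Finset.mem_coe,
      mem_piAntidiag_univ]
  rw [hfiber]
  exact (Finset.tsum_subtype' _ f).symm

theorem hasSum_taylorCoeff_mul_monomial {U : Set (Fin n → ℂ)} (hU : IsOpen U) (hUc : Convex ℝ U)
    (h0 : 0 ∈ U) {g : (Fin n → ℂ) → ℂ} (hg : DifferentiableOn ℂ g U) {w : Fin n → ℂ} (hw : w ∈ U)
    (hs : Summable fun β => ‖taylorCoeff g β * monomial β w‖) :
    HasSum (fun β => taylorCoeff g β * monomial β w) (g w) := by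
  let ℓ : ℂ →ₗ[ℝ] (Fin n → ℂ) := (LinearMap.toSpanSingleton ℂ (Fin n → ℂ) w).restrictScalars ℝ
  have hslice : HasSum (fun d => taylorHomogeneous g d w) (g ((1 : ℂ) • w)) := by
    refine hasSum_apply_one_of_eventually_hasSum (V := ℓ ⁻¹' U) (g := fun ζ => g (ζ • w))
      (hU.preimage (continuous_id.smul continuous_const)) (hUc.linear_preimage ℓ) ?_ ?_
      (hg.comp (by fun_prop) fun ζ hζ => hζ)
      (.of_nonneg_of_le (fun _ => norm_nonneg _) (fun _ => norm_sum_le _ _)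
        (hasSum_sum_piAntidiag hs.hasSum).summable) ?_
    · rwa [Set.mem_preimage, map_zero]
    · change (1 : ℂ) • w ∈ U
      rwa [one_smul]
    · simpa only [smul_eq_mul, mul_comm] using eventually_hasSum_taylorHomogeneous hU h0 hg w
  rw [one_smul] at hslice
  have hsum := hs.of_norm.hasSum
  rwa [(hasSum_sum_piAntidiag hsum).unique hslice] at hsum

end Expansion

section LyapunovSeries

open Metric Finset

variable {n : ℕ}

theorem norm_monomial_le (α : Fin n → ℕ) (w : Fin n → ℂ) : ‖monomial α w‖ ≤ ‖w‖ ^ degree α := by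
  rw [monomial, norm_prod, degree, ← prod_pow_eq_pow_sum]
  gcongr with l
  rw [norm_pow]
  gcongr
  exact norm_le_pi_norm w l

theorem norm_fderiv_monomial_le (α : Fin n → ℕ) (w : Fin n → ℂ) :
    ‖fderiv ℂ (monomial α) w‖ ≤ degree α * ‖w‖ ^ (degree α - 1) := by
  rw [(hasFDerivAt_monomial α w).fderiv, degree, Nat.cast_sum, sum_mul]
  refine (norm_sum_le _ _).trans (sum_le_sum fun l _ => ?_)
  have hproj : ‖(ContinuousLinearMap.proj l : (Fin n → ℂ) →L[ℂ] ℂ)‖ ≤ 1 :=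
    ContinuousLinearMap.opNorm_le_bound _ zero_le_one fun h => by
      simpa using norm_le_pi_norm h l
  rw [norm_smul, norm_mul, Complex.norm_natCast]
  refine (mul_le_of_le_one_right (by positivity) hproj).trans ?_
  by_cases hl : α l = 0
  · simp [hl]
  · have hdeg := degree_sub_single_add_one hl
    rw [← degree, ← hdeg, Nat.add_sub_cancel]
    gcongr
    exact norm_monomial_le _ w

theorem contDiff_norm_sq_monomial (α : Fin n → ℕ) :
    ContDiff ℝ 1 fun w : Fin n → ℂ => ‖monomial α w‖ ^ 2 :=
  ContDiff.norm_sq ℝ <| contDiff_prod fun l _ => (contDiff_apply ℝ ℂ l).pow _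

theorem fderiv_norm_sq_monomial_apply (α : Fin n → ℕ) (w h : Fin n → ℂ) :
    fderiv ℝ (fun w => ‖monomial α w‖ ^ 2) w h
      = 2 * ((starRingEnd ℂ) (monomial α w) * fderiv ℂ (monomial α) w h).re := by
  have hderiv := ((differentiable_monomial α w).hasFDerivAt.restrictScalars ℝ).norm_sq
  rw [hderiv.fderiv]
  simp [Complex.inner]
  ring

theorem norm_fderiv_norm_sq_monomial_le (α : Fin n → ℕ) (w : Fin n → ℂ) :
    ‖fderiv ℝ (fun w => ‖monomial α w‖ ^ 2) w‖
      ≤ 2 * (‖w‖ ^ degree α * (degree α * ‖w‖ ^ (degree α - 1))) := by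
  refine ContinuousLinearMap.opNorm_le_bound _ (by positivity) fun h => ?_
  rw [fderiv_norm_sq_monomial_apply, norm_mul, Real.norm_two, mul_assoc]
  gcongr
  calc ‖((starRingEnd ℂ) (monomial α w) * fderiv ℂ (monomial α) w h).re‖
      ≤ ‖monomial α w‖ * ‖fderiv ℂ (monomial α) w h‖ := by
        rw [← Complex.norm_conj (monomial α w), ← norm_mul]
        exact Complex.abs_re_le_norm _
    _ ≤ ‖w‖ ^ degree α * (degree α * ‖w‖ ^ (degree α - 1) * ‖h‖) := by
        gcongr
        · exact norm_monomial_le α w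
        · exact ContinuousLinearMap.le_of_opNorm_le _ (norm_fderiv_monomial_le α w) h
    _ = ‖w‖ ^ degree α * (degree α * ‖w‖ ^ (degree α - 1)) * ‖h‖ := by ring

/-- The function `V(w) = ∑ ε_k |w^{α(k)}|²`, in the coordinates in which the linearizations are
triangular, for an arbitrary family of multi-indices `α`. -/
noncomputable def lyapunovSeries {ι : Type*} (ε : ι → ℝ) (α : ι → Fin n → ℕ) (w : Fin n → ℂ) : ℝ :=
  ∑' k, ε k * ‖monomial (α k) w‖ ^ 2

variable {ι : Type*} {ε : ι → ℝ} {α : ι → Fin n → ℕ} {ρ : ℝ} {w : Fin n → ℂ}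

theorem summable_lyapunovSeries (hε : ∀ k, 0 ≤ ε k) (hα : ∀ k, degree (α k) ≠ 0)
    (hs : Summable fun k => (degree (α k) : ℝ) * ε k * ρ ^ (2 * degree (α k)))
    (hw : ‖w‖ ≤ ρ) : Summable fun k => ε k * ‖monomial (α k) w‖ ^ 2 := by
  refine .of_nonneg_of_le (fun k => mul_nonneg (hε k) (sq_nonneg _)) (fun k => ?_) hs
  have hdeg : (1 : ℝ) ≤ degree (α k) := by exact_mod_cast Nat.one_le_iff_ne_zero.2 (hα k)
  have hmon := (norm_monomial_le (α k) w).trans (pow_le_pow_left₀ (norm_nonneg w) hw _)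
  rw [mul_comm 2, pow_mul]
  gcongr
  · exact mul_nonneg (Nat.cast_nonneg _) (hε k)
  · exact le_mul_of_one_le_left (hε k) hdeg

theorem norm_fderiv_lyapunovTerm_le (hε : ∀ k, 0 ≤ ε k) (hα : ∀ k, degree (α k) ≠ 0)
    (hρ : 0 < ρ) (hw : w ∈ ball 0 ρ) (k : ι) :
    ‖fderiv ℝ (fun w => ε k * ‖monomial (α k) w‖ ^ 2) w‖
      ≤ 2 / ρ * (degree (α k) * ε k * ρ ^ (2 * degree (α k))) := by
  have hw' : ‖w‖ ≤ ρ := (mem_ball_zero_iff.1 hw).le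
  rw [fderiv_const_mul ((contDiff_norm_sq_monomial _).differentiable one_ne_zero w), norm_smul,
    Real.norm_of_nonneg (hε k)]
  obtain ⟨d, hd⟩ := Nat.exists_eq_add_one_of_ne_zero (hα k)
  calc ε k * ‖fderiv ℝ (fun w => ‖monomial (α k) w‖ ^ 2) w‖
      ≤ ε k * (2 * (ρ ^ degree (α k) * (degree (α k) * ρ ^ (degree (α k) - 1)))) :=
        mul_le_mul_of_nonneg_left
          ((norm_fderiv_norm_sq_monomial_le (α k) w).trans (by gcongr)) (hε k)
    _ = 2 / ρ * (degree (α k) * ε k * ρ ^ (2 * degree (α k))) := by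
        rw [hd, Nat.add_sub_cancel]
        field_simp
        ring

theorem differentiable_lyapunovTerm (k : ι) :
    Differentiable ℝ fun w : Fin n → ℂ => ε k * ‖monomial (α k) w‖ ^ 2 :=
  ((contDiff_norm_sq_monomial _).differentiable one_ne_zero).const_mul _

theorem hasFDerivAt_lyapunovSeries (hε : ∀ k, 0 ≤ ε k) (hα : ∀ k, degree (α k) ≠ 0)
    (hs : Summable fun k => (degree (α k) : ℝ) * ε k * ρ ^ (2 * degree (α k)))
    (hw : w ∈ ball 0 ρ) :
    HasFDerivAt (lyapunovSeries ε α)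
      (∑' k, fderiv ℝ (fun w => ε k * ‖monomial (α k) w‖ ^ 2) w) w := by
  have hρ : 0 < ρ := pos_of_mem_ball hw
  exact hasFDerivAt_tsum_of_isPreconnected (hs.mul_left (2 / ρ)) isOpen_ball
    (convex_ball _ _).isPreconnected
    (fun k w _ => (differentiable_lyapunovTerm k w).hasFDerivAt)
    (fun k _ hw => norm_fderiv_lyapunovTerm_le hε hα hρ hw k) (mem_ball_self hρ)
    (summable_lyapunovSeries hε hα hs (norm_zero.trans_le hρ.le)) hw

theorem contDiffOn_lyapunovSeries (hε : ∀ k, 0 ≤ ε k) (hα : ∀ k, degree (α k) ≠ 0)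
    (hs : Summable fun k => (degree (α k) : ℝ) * ε k * ρ ^ (2 * degree (α k))) :
    ContDiffOn ℝ 1 (lyapunovSeries ε α) (ball 0 ρ) := by
  have hderiv := fun w hw => hasFDerivAt_lyapunovSeries (w := w) hε hα hs hw
  rw [← zero_add (1 : WithTop ℕ∞), contDiffOn_succ_iff_fderiv_of_isOpen isOpen_ball,
    contDiffOn_zero]
  refine ⟨fun w hw => (hderiv w hw).differentiableAt.differentiableWithinAt, by simp,
    ContinuousOn.congr ?_ fun w hw => (hderiv w hw).fderiv⟩
  refine continuousOn_tsum (u := fun k => 2 / ρ * (degree (α k) * ε k * ρ ^ (2 * degree (α k))))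
    (fun k => ?_) (hs.mul_left (2 / ρ))
    fun k w hw => norm_fderiv_lyapunovTerm_le hε hα (pos_of_mem_ball hw) hw k
  exact ((contDiff_const.mul (contDiff_norm_sq_monomial _)).continuous_fderiv
    one_ne_zero).continuousOn

theorem fderiv_lyapunovSeries_apply (hε : ∀ k, 0 ≤ ε k) (hα : ∀ k, degree (α k) ≠ 0)
    (hs : Summable fun k => (degree (α k) : ℝ) * ε k * ρ ^ (2 * degree (α k)))
    (hw : w ∈ ball 0 ρ) (h : Fin n → ℂ) :
    fderiv ℝ (lyapunovSeries ε α) w h = ∑' k, 2 * (ε k *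
      ((starRingEnd ℂ) (monomial (α k) w) * fderiv ℂ (monomial (α k)) w h).re) := by
  rw [(hasFDerivAt_lyapunovSeries hε hα hs hw).fderiv]
  have hsum : Summable fun k => fderiv ℝ (fun w => ε k * ‖monomial (α k) w‖ ^ 2) w :=
    .of_norm_bounded (hs.mul_left (2 / ρ))
      (norm_fderiv_lyapunovTerm_le hε hα (pos_of_mem_ball hw) hw)
  refine ((ContinuousLinearMap.apply ℝ ℝ h).map_tsum hsum).trans (tsum_congr fun k => ?_)
  rw [ContinuousLinearMap.apply_apply,
    fderiv_const_mul ((contDiff_norm_sq_monomial _).differentiable one_ne_zero w),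
    smul_apply, fderiv_norm_sq_monomial_apply, smul_eq_mul]
  ring

theorem monomial_zero_right {α : Fin n → ℕ} (hα : degree α ≠ 0) : monomial α 0 = 0 := by
  obtain ⟨l, hl, hαl⟩ := exists_ne_zero_of_sum_ne_zero hα
  exact prod_eq_zero hl (zero_pow hαl)

theorem lyapunovSeries_zero (hα : ∀ k, degree (α k) ≠ 0) : lyapunovSeries ε α 0 = 0 := by
  simp [lyapunovSeries, monomial_zero_right (hα _)]

theorem lyapunovSeries_pos (hε : ∀ k, 0 < ε k) (hα : ∀ k, degree (α k) ≠ 0)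
    (hs : Summable fun k => (degree (α k) : ℝ) * ε k * ρ ^ (2 * degree (α k)))
    (hw : ‖w‖ ≤ ρ) {k : ι} (hk : monomial (α k) w ≠ 0) : 0 < lyapunovSeries ε α w :=
  (summable_lyapunovSeries (fun k => (hε k).le) hα hs hw).tsum_pos
    (fun k => mul_nonneg (hε k).le (sq_nonneg _)) k
    (mul_pos (hε k) (pow_pos (norm_pos_iff.2 hk) 2))

end LyapunovSeries

section LyapunovDerivative

open Metric

variable {n : ℕ} [NeZero n]

theorem exists_monomial_ne_zero {w : Fin n → ℂ} (hw : w ≠ 0) :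
    ∃ k, monomial (monomialEnum n (k + 1)) w ≠ 0 := by
  obtain ⟨l, hl⟩ := Function.ne_iff.1 hw
  obtain ⟨k, hk⟩ := (monomialEnum_bijective n).2 (Pi.single l 1)
  have hmon : monomial (monomialEnum n k) w = w l := by
    rw [hk, monomial, Finset.prod_eq_single l (fun i _ hi => by simp [hi]) (by simp),
      Pi.single_eq_same, pow_one]
  obtain - | k := k
  · exact absurd (congrFun hk l) (by simp [monomialEnum_zero])
  · exact ⟨k, hmon.trans_ne hl⟩

variable {U : Set (Fin n → ℂ)} {G : (Fin n → ℂ) → (Fin n → ℂ)} {ρ : ℝ} {w : Fin n → ℂ}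

theorem norm_koopmanEntry_diag_le (hU : IsOpen U) (h0 : 0 ∈ U) (hG : DifferentiableOn ℂ G U)
    (hG0 : G 0 = 0) {k : ℕ} (hk : 1 ≤ k) :
    ‖koopmanEntry G k k‖ ≤ (∑ l, ‖jacobian G 0 l l‖) * degree (monomialEnum n k) := by
  rw [koopmanEntry_diag hU h0 hG hG0 hk, Finset.sum_mul]
  refine (norm_sum_le _ _).trans (Finset.sum_le_sum fun l _ => ?_)
  rw [norm_mul, Complex.norm_natCast, mul_comm]
  gcongr
  exact Finset.single_le_sum (fun _ _ => Nat.zero_le _) (Finset.mem_univ l)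

theorem re_koopmanEntry_diag_neg (hU : IsOpen U) (h0 : 0 ∈ U) (hG : DifferentiableOn ℂ G U)
    (hG0 : G 0 = 0) (hJ : ∀ l, (jacobian G 0 l l).re < 0) {k : ℕ} (hk : 1 ≤ k) :
    (koopmanEntry G k k).re < 0 := by
  obtain ⟨l, -, hl⟩ :=
    Finset.exists_ne_zero_of_sum_ne_zero (degree_monomialEnum_ne_zero (n := n) hk)
  simp only [koopmanEntry_diag hU h0 hG hG0 hk, Complex.re_sum, ← nsmul_eq_mul, Complex.re_nsmul]
  simp only [nsmul_eq_mul]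
  exact Finset.sum_neg'
    (fun i _ => mul_nonpos_of_nonneg_of_nonpos (Nat.cast_nonneg _) (hJ i).le)
    ⟨l, Finset.mem_univ l, mul_neg_of_pos_of_neg (Nat.cast_pos.2 (Nat.pos_of_ne_zero hl)) (hJ l)⟩

theorem isDominated_koopmanEntry (hU : IsOpen U) (h0 : 0 ∈ U) (hG : DifferentiableOn ℂ G U)
    (hG0 : G 0 = 0) (hJ : (jacobian G 0).BlockTriangular id)
    (hJneg : ∀ l, (jacobian G 0 l l).re < 0) {ε : ℕ → ℝ} {b : ℕ → ℕ → ℝ}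
    (hb0 : ∀ j k, 1 ≤ j → 1 ≤ k → 0 ≤ b j k)
    (hb : ∀ j k, 1 ≤ j → 1 ≤ k → koopmanEntry G k j ≠ 0 → 0 < b j k * b k j)
    (hbs : ∀ j, 1 ≤ j → Summable (fun k : ℕ => b j (k + 1)) ∧ ∑' k : ℕ, b j (k + 1) ≤ 1)
    (hε : ∀ j, 1 ≤ j → 0 < ε j)
    (hεQ : ∀ j k, 1 ≤ k → k < j → ε k * crossRatio G b j k < ε j) :
    IsDominated (fun k => ε (k + 1)) (fun k j => koopmanEntry G (k + 1) (j + 1))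
      (fun j k => b (j + 1) (k + 1)) where
  eps_pos j := hε _ (by omega)
  triangular k j hjk := koopmanEntry_eq_zero hU h0 hG hG0 hJ (by omega)
  diag_neg k := re_koopmanEntry_diag_neg hU h0 hG hG0 hJneg (by omega)
  nonneg j k := hb0 _ _ (by omega) (by omega)
  pos j k := hb _ _ (by omega) (by omega)
  summable j := (hbs _ (by omega)).1
  tsum_le j := (hbs _ (by omega)).2
  lt k j hkj hne := by
    have hlt := hεQ (j + 1) (k + 1) (by omega) (by omega)
    rwa [crossRatio, if_pos hne] at hlt

theorem summable_norm_koopmanEntry_diag_mul (hU : IsOpen U) (h0 : 0 ∈ U)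
    (hG : DifferentiableOn ℂ G U) (hG0 : G 0 = 0) {ε : ℕ → ℝ} (hε : ∀ k, 0 ≤ ε k)
    (hs : Summable fun k => (degree (monomialEnum n (k + 1)) : ℝ) * ε k
      * ρ ^ (2 * degree (monomialEnum n (k + 1)))) (hw : ‖w‖ ≤ ρ) :
    Summable fun j => ‖koopmanEntry G (j + 1) (j + 1)‖
      * (ε j * ‖monomial (monomialEnum n (j + 1)) w‖ ^ 2) := by
  refine .of_nonneg_of_le
    (fun j => mul_nonneg (norm_nonneg _) (mul_nonneg (hε j) (sq_nonneg _))) (fun j => ?_)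
    (hs.mul_left (∑ l, ‖jacobian G 0 l l‖))
  have hmon : ‖monomial (monomialEnum n (j + 1)) w‖ ^ 2
      ≤ ρ ^ (2 * degree (monomialEnum n (j + 1))) := by
    rw [mul_comm, pow_mul]
    gcongr
    exact (norm_monomial_le _ w).trans (by gcongr)
  calc _ ≤ (∑ l, ‖jacobian G 0 l l‖) * degree (monomialEnum n (j + 1))
        * (ε j * ρ ^ (2 * degree (monomialEnum n (j + 1)))) := by
        have hεj := hε j
        gcongr
        exact norm_koopmanEntry_diag_le hU h0 hG hG0 (by omega)
    _ = _ := by ring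

theorem hasSum_taylorCoeff_mul_monomial_monomialEnum (hU : IsOpen U) (hUc : Convex ℝ U)
    (h0 : 0 ∈ U) {g : (Fin n → ℂ) → ℂ} (hg : DifferentiableOn ℂ g U) (hw : w ∈ U)
    (hs : Summable fun j => ‖taylorCoeff g (monomialEnum n j) * monomial (monomialEnum n j) w‖) :
    HasSum (fun j => taylorCoeff g (monomialEnum n j) * monomial (monomialEnum n j) w) (g w) := by
  let e : ℕ ≃ (Fin n → ℕ) := .ofBijective _ (monomialEnum_bijective n)
  let c : (Fin n → ℕ) → ℂ := fun β => taylorCoeff g β * monomial β w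
  have hsc : Summable fun β => ‖c β‖ := e.summable_iff.1 hs
  exact (e.hasSum_iff (f := c)).2 (hasSum_taylorCoeff_mul_monomial hU hUc h0 hg hw hsc)

theorem hasSum_koopmanEntry_mul_monomial (hU : IsOpen U) (hUc : Convex ℝ U) (h0 : 0 ∈ U)
    (hG : DifferentiableOn ℂ G U) (hG0 : G 0 = 0) (hJ : (jacobian G 0).BlockTriangular id)
    (hw : w ∈ U) {k : ℕ} (hk : 1 ≤ k)
    (hs : Summable fun j => ‖koopmanEntry G k (j + 1) * monomial (monomialEnum n (j + 1)) w‖) :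
    HasSum (fun j => koopmanEntry G k (j + 1) * monomial (monomialEnum n (j + 1)) w)
      (koopmanGenerator G (monomial (monomialEnum n k)) w) := by
  have hsum : HasSum (fun j => koopmanEntry G k j * monomial (monomialEnum n j) w)
      (koopmanGenerator G (monomial (monomialEnum n k)) w) := by
    have hs' := (summable_nat_add_iff
      (f := fun j => ‖koopmanEntry G k j * monomial (monomialEnum n j) w‖) 1).1 hs
    simp only [koopmanEntry_eq_taylorCoeff] at hs' ⊢
    exact hasSum_taylorCoeff_mul_monomial_monomialEnum hU hUc h0
      (differentiableOn_koopmanGenerator hG _) hw hs'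
  rw [← hasSum_nat_add_iff' 1] at hsum
  simpa only [Finset.sum_range_one, koopmanEntry_eq_zero hU h0 hG hG0 hJ hk, zero_mul,
    sub_zero] using hsum

theorem fderiv_lyapunovSeries_neg (hU : IsOpen U) (hUc : Convex ℝ U) (h0 : 0 ∈ U)
    (hG : DifferentiableOn ℂ G U) (hG0 : G 0 = 0) (hJ : (jacobian G 0).BlockTriangular id)
    {ε : ℕ → ℝ} {b : ℕ → ℕ → ℝ}
    (hdom : IsDominated ε (fun k j => koopmanEntry G (k + 1) (j + 1)) b)
    (hs : Summable fun k => (degree (monomialEnum n (k + 1)) : ℝ) * ε k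
      * ρ ^ (2 * degree (monomialEnum n (k + 1))))
    (hwU : w ∈ U) (hw : w ∈ ball 0 ρ) (hw0 : w ≠ 0) :
    fderiv ℝ (lyapunovSeries ε fun k => monomialEnum n (k + 1)) w (G w) < 0 := by
  have hdeg : ∀ k, degree (monomialEnum n (k + 1)) ≠ 0 := fun k =>
    degree_monomialEnum_ne_zero (by omega)
  let v : ℕ → ℂ := fun k => monomial (monomialEnum n (k + 1)) w
  have hsA := summable_norm_koopmanEntry_diag_mul hU h0 hG hG0 (fun k => (hdom.eps_pos k).le) hs
    (mem_ball_zero_iff.1 hw).le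
  obtain ⟨k₀, hk₀⟩ := exists_monomial_ne_zero hw0
  refine lt_of_eq_of_lt ?_ (hdom.tsum_re_neg (v := v) hsA hk₀)
  rw [fderiv_lyapunovSeries_apply (fun k => (hdom.eps_pos k).le) hdeg hs hw,
    (hdom.summable_re (v := v) hsA).tsum_prod]
  refine tsum_congr fun k => ?_
  by_cases hk : v k = 0
  · simp [hk, show monomial (monomialEnum n (k + 1)) w = 0 from hk]
  have hsk : Summable fun j => ‖koopmanEntry G (k + 1) (j + 1) * v j‖ := by
    refine (((hdom.summable_eps_mul_norm (v := v) hsA).prod_factor k).mul_left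
      (ε k * ‖v k‖)⁻¹).congr fun j => ?_
    have hεk := (hdom.eps_pos k).ne'
    have hvk := norm_ne_zero_iff.2 hk
    rw [norm_mul]
    field_simp
  have hgen := hasSum_koopmanEntry_mul_monomial hU hUc h0 hG hG0 hJ hwU (by omega) hsk
  exact (((Complex.reCLM.hasSum (hgen.mul_left ((starRingEnd ℂ) (v k)))).mul_left
    (ε k)).mul_left 2).tsum_eq.symm

theorem isCommonLyapunov_lyapunovSeries {m : ℕ} {G : Fin m → (Fin n → ℂ) → (Fin n → ℂ)}
    (hU : IsOpen U) (hUc : Convex ℝ U) (h0 : 0 ∈ U) (hG : ∀ i, DifferentiableOn ℂ (G i) U)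
    (hG0 : ∀ i, G i 0 = 0) (hJ : ∀ i, (jacobian (G i) 0).BlockTriangular id)
    {ε : ℕ → ℝ} (hε : ∀ k, 0 < ε k) {b : Fin m → ℕ → ℕ → ℝ}
    (hdom : ∀ i, IsDominated ε (fun k j => koopmanEntry (G i) (k + 1) (j + 1)) (b i))
    (hs : Summable fun k => (degree (monomialEnum n (k + 1)) : ℝ) * ε k
      * ρ ^ (2 * degree (monomialEnum n (k + 1)))) :
    IsCommonLyapunov G (U ∩ ball 0 ρ) (lyapunovSeries ε fun k => monomialEnum n (k + 1)) := by
  have hdeg : ∀ k, degree (monomialEnum n (k + 1)) ≠ 0 := fun k =>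
    degree_monomialEnum_ne_zero (by omega)
  refine ⟨(contDiffOn_lyapunovSeries (fun k => (hε k).le) hdeg hs).mono Set.inter_subset_right,
    lyapunovSeries_zero hdeg, fun w hw hw0 => ?_, fun i w hw hw0 => ?_⟩
  · obtain ⟨k, hk⟩ := exists_monomial_ne_zero hw0
    exact lyapunovSeries_pos hε hdeg hs (mem_ball_zero_iff.1 hw.2).le hk
  · exact fderiv_lyapunovSeries_neg hU hUc h0 (hG i) (hG0 i) (hJ i) (hdom i) hs hw.1 hw.2 hw0

end LyapunovDerivative

section ConjugateField

variable {n : ℕ} {P : Matrix (Fin n) (Fin n) ℂ} {F : (Fin n → ℂ) → (Fin n → ℂ)}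
  {U : Set (Fin n → ℂ)}

theorem convex_polydisk (ρ : ℝ) : Convex ℝ (polydisk n ρ) := by
  have hinter : polydisk n ρ = ⋂ l, (fun z : Fin n → ℂ => z l) ⁻¹' Metric.ball (0 : ℂ) ρ := by
    ext
    simp [polydisk]
  rw [hinter]
  exact convex_iInter fun l => (convex_ball (0 : ℂ) ρ).linear_preimage
    (LinearMap.proj (R := ℝ) (φ := fun _ : Fin n => ℂ) l)

theorem continuous_mulVec (B : Matrix (Fin n) (Fin n) ℂ) : Continuous (B *ᵥ ·) :=
  continuous_const.matrix_mulVec continuous_id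

theorem hasFDerivAt_mulVec (B : Matrix (Fin n) (Fin n) ℂ) (z : Fin n → ℂ) :
    HasFDerivAt (B *ᵥ ·) (LinearMap.toContinuousLinearMap B.mulVecLin) z :=
  (LinearMap.toContinuousLinearMap B.mulVecLin).hasFDerivAt

theorem hasFDerivAt_conjField {w : Fin n → ℂ} (hF : DifferentiableAt ℂ F (P *ᵥ w)) :
    HasFDerivAt (conjField P F) ((LinearMap.toContinuousLinearMap P⁻¹.mulVecLin).comp
      ((fderiv ℂ F (P *ᵥ w)).comp (LinearMap.toContinuousLinearMap P.mulVecLin))) w :=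
  (hasFDerivAt_mulVec P⁻¹ _).comp w (hF.hasFDerivAt.comp w (hasFDerivAt_mulVec P w))

theorem differentiableOn_conjField (hU : IsOpen U) (hF : DifferentiableOn ℂ F U) :
    DifferentiableOn ℂ (conjField P F) ((P *ᵥ ·) ⁻¹' U) := fun _ hw =>
  (hasFDerivAt_conjField
    (hF.differentiableAt (hU.mem_nhds hw))).differentiableAt.differentiableWithinAt

theorem conjField_zero (hF0 : F 0 = 0) : conjField P F 0 = 0 := by
  rw [conjField, Matrix.mulVec_zero, hF0, Matrix.mulVec_zero]

theorem jacobian_conjField_zero (hF : DifferentiableAt ℂ F 0) :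
    jacobian (conjField P F) 0 = P⁻¹ * jacobian F 0 * P := by
  rw [← Matrix.mulVec_zero P] at hF
  rw [jacobian, (hasFDerivAt_conjField hF).fderiv, Matrix.mulVec_zero]
  change LinearMap.toMatrix' (Matrix.toLin' P⁻¹ ∘ₗ
    ((fderiv ℂ F 0 : (Fin n → ℂ) →ₗ[ℂ] (Fin n → ℂ)) ∘ₗ Matrix.toLin' P)) = _
  rw [LinearMap.toMatrix'_comp, LinearMap.toMatrix'_comp, LinearMap.toMatrix'_toLin',
    LinearMap.toMatrix'_toLin', jacobian, mul_assoc]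

theorem diag_mem_spectrum {ι K : Type*} [Fintype ι] [LinearOrder ι] [Field K]
    {T : Matrix ι ι K} (hT : T.BlockTriangular id) (l : ι) : T l l ∈ spectrum K T := by
  rw [spectrum.mem_iff, Matrix.isUnit_iff_isUnit_det, isUnit_iff_ne_zero, not_not,
    Matrix.algebraMap_eq_diagonal,
    Matrix.det_of_isUpperTriangular ((Matrix.blockTriangular_diagonal _).sub hT)]
  exact Finset.prod_eq_zero (Finset.mem_univ l) (by simp)

theorem spectrum_nonsing_inv_conj (hP : IsUnit P) (J : Matrix (Fin n) (Fin n) ℂ) :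
    spectrum ℂ (P⁻¹ * J * P) = spectrum ℂ J := by
  obtain ⟨u, rfl⟩ := hP
  rw [← Matrix.coe_units_inv, spectrum.units_conjugate']

theorem re_jacobian_conjField_zero_diag_neg (hP : IsUnit P) (hF : DifferentiableAt ℂ F 0)
    (hT : (P⁻¹ * jacobian F 0 * P).BlockTriangular id)
    (hneg : ∀ μ ∈ spectrum ℂ (jacobian F 0), μ.re < 0) (l : Fin n) :
    (jacobian (conjField P F) 0 l l).re < 0 := by
  rw [jacobian_conjField_zero hF]
  exact hneg _ (spectrum_nonsing_inv_conj hP (jacobian F 0) ▸ diag_mem_spectrum hT l)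

theorem norm_mulVec_le_infNorm_mul (B : Matrix (Fin n) (Fin n) ℂ) (z : Fin n → ℂ) :
    ‖B *ᵥ z‖ ≤ infNorm B * ‖z‖ :=
  open scoped Matrix.Norms.Operator in Matrix.linfty_opNorm_mulVec B z

theorem mulVec_inv_mulVec (hP : IsUnit P) (z : Fin n → ℂ) : P *ᵥ (P⁻¹ *ᵥ z) = z := by
  rw [Matrix.mulVec_mulVec, Matrix.mul_nonsing_inv P ((Matrix.isUnit_iff_isUnit_det P).1 hP),
    Matrix.one_mulVec]

theorem IsCommonLyapunov.differentiableAt {m : ℕ} {F : Fin m → (Fin n → ℂ) → (Fin n → ℂ)}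
    {D : Set (Fin n → ℂ)} {V : (Fin n → ℂ) → ℝ} (hV : IsCommonLyapunov F D V) (hD : IsOpen D)
    {z : Fin n → ℂ} (hz : z ∈ D) : DifferentiableAt ℝ V z :=
  (hV.contDiffOn.differentiableOn one_ne_zero).differentiableAt (hD.mem_nhds hz)

theorem IsCommonLyapunov.comp_inv_mulVec {m : ℕ} {F : Fin m → (Fin n → ℂ) → (Fin n → ℂ)}
    {D D' : Set (Fin n → ℂ)} {V : (Fin n → ℂ) → ℝ} (hP : IsUnit P)
    (hV : IsCommonLyapunov (fun i => conjField P (F i)) D' V) (hD' : IsOpen D')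
    (hmaps : Set.MapsTo (P⁻¹ *ᵥ ·) D D') : IsCommonLyapunov F D (fun z => V (P⁻¹ *ᵥ z)) := by
  have hne : ∀ z, z ≠ 0 → P⁻¹ *ᵥ z ≠ 0 := fun z hz h => hz <| by
    rw [← mulVec_inv_mulVec hP z, h, Matrix.mulVec_zero]
  let B : (Fin n → ℂ) →L[ℝ] (Fin n → ℂ) :=
    (LinearMap.toContinuousLinearMap P⁻¹.mulVecLin).restrictScalars ℝ
  refine ⟨hV.contDiffOn.comp B.contDiff.contDiffOn hmaps, by simp [hV.zero],
    fun z hz hz0 => hV.pos _ (hmaps hz) (hne z hz0), fun i z hz hz0 => ?_⟩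
  have hneg := hV.deriv_neg i _ (hmaps hz) (hne z hz0)
  simp only [conjField, mulVec_inv_mulVec hP] at hneg
  have hVd : DifferentiableAt ℝ V (B z) := hV.differentiableAt hD' (hmaps hz)
  have hcomp := (hVd.hasFDerivAt.comp z B.hasFDerivAt).fderiv
  change fderiv ℝ (V ∘ B) z (F i z) < 0
  rwa [hcomp]

theorem isDominated_koopmanEntry_conjField [NeZero n] (hU : IsOpen U) (h0 : 0 ∈ U)
    (hF : DifferentiableOn ℂ F U) (hF0 : F 0 = 0) (hP : IsUnit P)
    (hT : (P⁻¹ * jacobian F 0 * P).BlockTriangular id)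
    (hneg : ∀ μ ∈ spectrum ℂ (jacobian F 0), μ.re < 0) {ε : ℕ → ℝ} {b : ℕ → ℕ → ℝ}
    (hb0 : ∀ j k, 1 ≤ j → 1 ≤ k → 0 ≤ b j k)
    (hb : ∀ j k, 1 ≤ j → 1 ≤ k → koopmanEntry (conjField P F) k j ≠ 0 → 0 < b j k * b k j)
    (hbs : ∀ j, 1 ≤ j → Summable (fun k : ℕ => b j (k + 1)) ∧ ∑' k : ℕ, b j (k + 1) ≤ 1)
    (hε : ∀ j, 1 ≤ j → 0 < ε j)
    (hεQ : ∀ j k, 1 ≤ k → k < j → ε k * crossRatio (conjField P F) b j k < ε j) :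
    IsDominated (fun k => ε (k + 1)) (fun k j => koopmanEntry (conjField P F) (k + 1) (j + 1))
      (fun j k => b (j + 1) (k + 1)) := by
  have hF' : DifferentiableAt ℂ F 0 := hF.differentiableAt (hU.mem_nhds h0)
  exact isDominated_koopmanEntry (hU.preimage (continuous_mulVec P)) (by simpa using h0)
    (differentiableOn_conjField hU hF) (conjField_zero hF0) (jacobian_conjField_zero hF' ▸ hT)
    (re_jacobian_conjField_zero_diag_neg hP hF' hT hneg) hb0 hb hbs hε hεQ

theorem IsNormalizedTriangularizer.norm_inv_mulVec_le {m : ℕ} {A : Fin m → Matrix (Fin n) (Fin n) ℂ}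
    (hP : IsNormalizedTriangularizer A P) (z : Fin n → ℂ) : ‖P⁻¹ *ᵥ z‖ ≤ ‖z‖ := by
  simpa only [hP.2.1, one_mul] using norm_mulVec_le_infNorm_mul P⁻¹ z

theorem IsNormalizedTriangularizer.isCommonLyapunov_lyapunovSeries [NeZero n] {m : ℕ}
    {F : Fin m → (Fin n → ℂ) → (Fin n → ℂ)} {ρ : ℝ}
    (hP : IsNormalizedTriangularizer (fun i => jacobian (F i) 0) P)
    (hU : IsOpen U) (hUconv : Convex ℝ U) (h0 : 0 ∈ U) (hball : Metric.ball 0 ρ ⊆ U)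
    (hF : ∀ i, DifferentiableOn ℂ (F i) U) (hF0 : ∀ i, F i 0 = 0)
    {ε : ℕ → ℝ} (hε : ∀ k, 0 < ε k) {b : Fin m → ℕ → ℕ → ℝ}
    (hdom : ∀ i,
      IsDominated ε (fun k j => koopmanEntry (conjField P (F i)) (k + 1) (j + 1)) (b i))
    (hs : Summable fun k => (degree (monomialEnum n (k + 1)) : ℝ) * ε k
      * ρ ^ (2 * degree (monomialEnum n (k + 1)))) :
    IsCommonLyapunov F (Metric.ball 0 ρ)
      (fun z => lyapunovSeries ε (fun k => monomialEnum n (k + 1)) (P⁻¹ *ᵥ z)) := by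
  have hU' : IsOpen ((P *ᵥ ·) ⁻¹' U) := hU.preimage (continuous_mulVec P)
  have hU'conv : Convex ℝ ((P *ᵥ ·) ⁻¹' U) :=
    hUconv.linear_preimage (P.mulVecLin.restrictScalars ℝ)
  have hJ : ∀ i, (jacobian (conjField P (F i)) 0).BlockTriangular id := fun i =>
    jacobian_conjField_zero (P := P) ((hF i).differentiableAt (hU.mem_nhds h0)) ▸ hP.2.2 i
  have hV := SwitchedKoopman.isCommonLyapunov_lyapunovSeries hU' hU'conv (by simpa using h0)
    (fun i => differentiableOn_conjField hU (hF i)) (fun i => conjField_zero (hF0 i)) hJ hε hdom hs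
  refine hV.comp_inv_mulVec hP.1 (hU'.inter Metric.isOpen_ball) fun z hz => ⟨?_, ?_⟩
  · simpa only [Set.mem_preimage, mulVec_inv_mulVec hP.1] using hball hz
  · exact mem_ball_zero_iff.2 ((hP.norm_inv_mulVec_le z).trans_lt (mem_ball_zero_iff.1 hz))

end ConjugateField

section Monotonicity

open Filter Set

theorem le_of_forall_eventually_le {u : ℝ → ℝ} {a b c : ℝ} (hab : a ≤ b)
    (hu : ContinuousOn u (Icc a b))
    (h : ∀ t ∈ Ioo a b, u t < c → ∀ᶠ s in 𝓝[>] t, u s ≤ u t) (ha : u a < c) : u b ≤ u a := by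
  obtain rfl | hab := hab.eq_or_lt
  · exact le_rfl
  have hcont : Tendsto u (𝓝[>] a) (𝓝 (u a)) :=
    ((hu a (left_mem_Icc.2 hab.le)).mono_of_mem_nhdsWithin (Icc_mem_nhdsGT hab)).tendsto
  refine ge_of_tendsto hcont ?_
  filter_upwards [Ioo_mem_nhdsGT hab, hcont.eventually (gt_mem_nhds ha)] with a' ha' hlt
  have hclosed : IsClosed ({t | u t ≤ u a'} ∩ Icc a' b) := by
    rw [inter_comm]
    exact (hu.mono (Icc_subset_Icc_left ha'.1.le)).preimage_isClosed_of_isClosed isClosed_Icc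
      isClosed_Iic
  refine hclosed.Icc_subset_of_forall_exists_gt (mem_ofPred.2 le_rfl) (fun t ht y hy => ?_)
    (right_mem_Icc.2 ha'.2.le)
  have hle : u t ≤ u a' := ht.1
  obtain ⟨s, hs, hsy⟩ := ((h t ⟨ha'.1.trans_le ht.2.1, ht.2.2⟩ (hle.trans_lt hlt)).and
    (Ioc_mem_nhdsGT hy)).exists
  exact ⟨s, hs.trans hle, hsy⟩

theorem le_of_forall_notMem_eventually_le {u : ℝ → ℝ} {c : ℝ} {S : Set ℝ} (hS : S.Finite)
    {a b : ℝ} (hab : a ≤ b) (hu : ContinuousOn u (Icc a b))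
    (h : ∀ t ∈ Ioo a b, t ∉ S → u t < c → ∀ᶠ s in 𝓝[>] t, u s ≤ u t) (ha : u a < c) :
    u b ≤ u a := by
  induction S, hS using Set.Finite.induction_on generalizing a b with
  | empty => exact le_of_forall_eventually_le hab hu (fun t ht => h t ht (notMem_empty t)) ha
  | @insert p S _ _ ih =>
    by_cases hp : p ∈ Ioo a b
    · have hle : u p ≤ u a := ih hp.1.le (hu.mono (Icc_subset_Icc_right hp.2.le))
        (fun t ht htS => h t ⟨ht.1, ht.2.trans hp.2⟩ (by simp [htS, ht.2.ne])) ha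
      exact (ih hp.2.le (hu.mono (Icc_subset_Icc_left hp.1.le)) (fun t ht htS =>
        h t ⟨hp.1.trans ht.1, ht.2⟩ (by simp [htS, ht.1.ne'])) (hle.trans_lt ha)).trans hle
    · exact ih hab hu (fun t ht htS => h t ht <| by
        rintro (rfl | htS')
        exacts [hp ht, htS htS']) ha

theorem eventually_le_of_hasDerivWithinAt_neg {u : ℝ → ℝ} {d t : ℝ}
    (h : HasDerivWithinAt u d (Ici t) t) (hd : d < 0) : ∀ᶠ s in 𝓝[>] t, u s ≤ u t := by
  have hslope := (hasDerivWithinAt_iff_tendsto_slope' self_notMem_Ioi).1 h.Ioi_of_Ici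
  filter_upwards [hslope.eventually (gt_mem_nhds hd), self_mem_nhdsWithin] with s hs hts
  rw [slope_def_field, div_lt_iff₀ (sub_pos.2 hts), zero_mul, sub_neg] at hs
  exact hs.le

end Monotonicity

section SwitchedTrajectory

open Filter Set Metric

variable {n m : ℕ} {X D : Set (Fin n → ℂ)} {F : Fin m → (Fin n → ℂ) → (Fin n → ℂ)}
  {σ : ℝ → Fin m} {x : ℝ → (Fin n → ℂ)} {V : (Fin n → ℂ) → ℝ}

theorem IsCommutationLaw.le_of_eventually_le (hσ : IsCommutationLaw σ) {u : ℝ → ℝ} {a b c : ℝ}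
    (ha : 0 ≤ a) (hab : a ≤ b) (hu : ContinuousOn u (Icc a b))
    (h : ∀ t ∈ Ioo a b, ContinuousWithinAt σ (Ici 0) t → u t < c → ∀ᶠ s in 𝓝[>] t, u s ≤ u t)
    (hc : u a < c) : u b ≤ u a :=
  le_of_forall_notMem_eventually_le (hσ b) hab hu (fun t ht htσ => h t ht <|
    not_not.1 fun hcont => htσ ⟨ha.trans ht.1.le, ht.2.le, hcont⟩) hc

theorem IsSwitchedTrajectory.exists_isSolution (hx : IsSwitchedTrajectory X F σ x) {t : ℝ}
    (ht : 0 ≤ t) (hσ : ContinuousWithinAt σ (Ici 0) t) :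
    ∃ T > 0, IsSolution (F (σ t)) T fun s => x (t + s) := by
  have hconst : ∀ᶠ s in 𝓝[Ici 0] t, σ s = σ t :=
    hσ.tendsto.eventually_mem (s := {σ t}) (mem_nhds_discrete.2 rfl)
  obtain ⟨δ, hδ, hball⟩ := Metric.mem_nhdsWithin_iff.1 hconst
  refine ⟨δ, hδ, hx.continuousOn.comp (by fun_prop) fun s hs => add_nonneg ht hs.1, fun s hs => ?_⟩
  have hts : 0 ≤ t + s := add_nonneg ht hs.1
  have hmem : t + s ∈ ball t δ := by
    rw [mem_ball, Real.dist_eq, add_sub_cancel_left, abs_of_nonneg hs.1]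
    exact hs.2
  have hval : σ (t + s) = σ t := hball ⟨hmem, hts⟩
  have hcont : ContinuousWithinAt σ (Ici 0) (t + s) := by
    refine continuousWithinAt_const.congr_of_eventuallyEq (f := fun _ => σ t) ?_ hval
    filter_upwards [mem_nhdsWithin_of_mem_nhds (isOpen_ball.mem_nhds hmem),
      self_mem_nhdsWithin] with r hr hr0
    exact hball ⟨hr, hr0⟩
  simpa only [hval, one_smul, Function.comp_def] using
    (hx.deriv _ hts hcont).scomp (t' := Ici 0) s
      (((hasDerivAt_id s).const_add t).hasDerivWithinAt (s := Ici s))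
      (fun r hr => add_nonneg ht (hs.1.trans hr))

theorem IsSwitchedTrajectory.norm_le {φ : Fin m → ℝ → (Fin n → ℂ) → (Fin n → ℂ)} {ρ : ℝ}
    (hF : ∀ i, DifferentiableOn ℂ (F i) (polydisk n 1))
    (hφ : ∀ i, IsForwardFlow (polydisk n 1) (F i) (φ i)) (hF0 : ∀ i, F i 0 = 0) (hρ : ρ ≤ 1)
    (hinv : ∀ i, ∀ t, 0 ≤ t → MapsTo (φ i t) (polydisk n ρ) (polydisk n ρ))
    (hσ : IsCommutationLaw σ) (hx : IsSwitchedTrajectory (polydisk n 1) F σ x) {a b : ℝ}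
    (ha : 0 ≤ a) (hab : a ≤ b) (hlt : ‖x a‖ < ρ) : ‖x b‖ ≤ ‖x a‖ := by
  refine hσ.le_of_eventually_le (u := fun t => ‖x t‖) (c := ρ) ha hab
    (hx.continuousOn.mono fun t ht => ha.trans ht.1).norm (fun t ht hc htρ => ?_) hlt
  have ht0 : 0 ≤ t := ha.trans ht.1.le
  obtain ⟨T, hT, hsol⟩ := hx.exists_isSolution ht0 hc
  have heq := (hφ (σ t)).eqOn (isOpen_polydisk 1) (hF _) hsol (by simpa using hx.mem t ht0)
  filter_upwards [Ioo_mem_nhdsGT (lt_add_of_pos_right t hT)] with s hs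
  have hst : 0 ≤ s - t := sub_nonneg.2 hs.1.le
  have hflow : x s = φ (σ t) (s - t) (x t) := by
    simpa using heq ⟨hst, (sub_lt_iff_lt_add'.2 hs.2).le⟩
  rw [hflow]
  exact IsForwardFlow.norm_le (hF _) (hφ _) (hF0 _) hρ (hinv _) htρ hst

theorem IsCommonLyapunov.exists_fderiv_lt_neg (hV : IsCommonLyapunov F D V) (hD : IsOpen D)
    (hF : ∀ i, ContinuousOn (F i) D) {K : Set (Fin n → ℂ)} (hK : IsCompact K) (hKD : K ⊆ D)
    (h0 : 0 ∉ K) : ∃ κ > 0, ∀ i, ∀ z ∈ K, fderiv ℝ V z (F i z) < -κ := by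
  have hcont : ContinuousOn (fun p : Fin m × (Fin n → ℂ) => -fderiv ℝ V p.2 (F p.1 p.2))
      (univ ×ˢ K) := continuousOn_prod_of_discrete_left.2 fun i =>
    (((hV.contDiffOn.continuousOn_fderiv_of_isOpen hD le_rfl).clm_apply (hF i)).mono
      fun z hz => hKD hz.2).neg
  obtain ⟨κ', hκ', hle⟩ := (isCompact_univ.prod hK).exists_forall_le' hcont (a := 0)
    fun p hp => neg_pos.2 (hV.deriv_neg p.1 p.2 (hKD hp.2) (ne_of_mem_of_not_mem hp.2 h0))
  obtain ⟨κ, hκ, hκκ'⟩ := exists_between hκ'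
  exact ⟨κ, hκ, fun i z hz => lt_neg.1 (hκκ'.trans_le (hle (i, z) ⟨mem_univ i, hz⟩))⟩

theorem IsSwitchedTrajectory.apply_add_mul_le (hσ : IsCommutationLaw σ)
    (hx : IsSwitchedTrajectory X F σ x) {K : Set (Fin n → ℂ)} (hxK : ∀ t, 0 ≤ t → x t ∈ K)
    (hV : ∀ z ∈ K, DifferentiableAt ℝ V z) {κ : ℝ}
    (hκ : ∀ i, ∀ z ∈ K, fderiv ℝ V z (F i z) < -κ) {T : ℝ} (hT : 0 ≤ T) :
    V (x T) + κ * T ≤ V (x 0) := by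
  have hcont : ContinuousOn (fun t => V (x t) + κ * t) (Icc 0 T) :=
    ContinuousOn.add (fun t ht => (hV _ (hxK t ht.1)).continuousAt.comp_continuousWithinAt
      ((hx.continuousOn t ht.1).mono Icc_subset_Ici_self)) (by fun_prop)
  have hle := hσ.le_of_eventually_le le_rfl hT hcont (c := V (x 0) + 1) (fun t ht hc _ => ?_)
    (by simp)
  · simpa using hle
  have hderiv := (hV _ (hxK t ht.1.le)).hasFDerivAt.comp_hasDerivWithinAt t
    ((hx.deriv t ht.1.le hc).mono (Ici_subset_Ici.2 ht.1.le))
  refine eventually_le_of_hasDerivWithinAt_neg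
    (hderiv.add ((hasDerivAt_id t).const_mul κ).hasDerivWithinAt) ?_
  linarith [hκ (σ t) _ (hxK t ht.1.le)]

theorem IsSwitchedTrajectory.tendsto_zero (hD : IsOpen D) (hF : ∀ i, ContinuousOn (F i) D)
    (hV : IsCommonLyapunov F D V) (hσ : IsCommutationLaw σ) (hx : IsSwitchedTrajectory X F σ x)
    (hx0 : closedBall 0 ‖x 0‖ ⊆ D) (hmono : ∀ a b, 0 ≤ a → a ≤ b → ‖x b‖ ≤ ‖x a‖) :
    Tendsto x atTop (𝓝 0) := by
  rw [Metric.tendsto_atTop]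
  by_contra! ⟨η, hη, hfreq⟩
  have hlow : ∀ t, 0 ≤ t → η ≤ ‖x t‖ := fun t ht => by
    obtain ⟨s, hts, hs⟩ := hfreq t
    exact (dist_zero_right (x s) ▸ hs).trans (hmono t s ht hts)
  let K : Set (Fin n → ℂ) := closedBall 0 ‖x 0‖ \ ball 0 η
  have hKD : K ⊆ D := sdiff_subset.trans hx0
  have hxK : ∀ t, 0 ≤ t → x t ∈ K := fun t ht =>
    ⟨mem_closedBall_zero_iff.2 (hmono 0 t le_rfl ht),
      fun hmem => (mem_ball_zero_iff.1 hmem).not_ge (hlow t ht)⟩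
  have hVpos : ∀ t, 0 ≤ t → 0 < V (x t) := fun t ht =>
    hV.pos _ (hKD (hxK t ht)) (norm_pos_iff.1 (hη.trans_le (hlow t ht)))
  obtain ⟨κ, hκ, hκK⟩ := hV.exists_fderiv_lt_neg hD hF
    ((isCompact_closedBall _ _).diff isOpen_ball) hKD fun h0 => h0.2 (mem_ball_self hη)
  have hT : 0 ≤ V (x 0) / κ := (div_pos (hVpos 0 le_rfl) hκ).le
  have hdecr := hx.apply_add_mul_le hσ hxK (fun z hz => hV.differentiableAt hD (hKD hz)) hκK hT
  rw [mul_div_cancel₀ _ hκ.ne'] at hdecr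
  linarith [hVpos _ hT]

theorem isGUAS_of_isCommonLyapunov {φ : Fin m → ℝ → (Fin n → ℂ) → (Fin n → ℂ)} {ρ : ℝ}
    (hF : ∀ i, DifferentiableOn ℂ (F i) (polydisk n 1))
    (hφ : ∀ i, IsForwardFlow (polydisk n 1) (F i) (φ i)) (hF0 : ∀ i, F i 0 = 0)
    (hρ0 : 0 < ρ) (hρ1 : ρ ≤ 1)
    (hinv : ∀ i, ∀ t, 0 ≤ t → MapsTo (φ i t) (polydisk n ρ) (polydisk n ρ))
    (hV : IsCommonLyapunov F (polydisk n ρ) V) : IsGUAS (polydisk n 1) F (polydisk n ρ) := by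
  have hsub : polydisk n ρ ⊆ polydisk n 1 := polydisk_subset_polydisk hρ1
  have hball := polydisk_eq_ball (n := n) hρ0
  have hnorm : ∀ {σ x}, IsCommutationLaw σ → IsSwitchedTrajectory (polydisk n 1) F σ x →
      ‖x 0‖ < ρ → ∀ t, 0 ≤ t → ‖x t‖ ≤ ‖x 0‖ := fun hσ hx h0 t ht =>
    hx.norm_le hF hφ hF0 hρ1 hinv hσ le_rfl ht h0
  have hlim : ∀ σ, IsCommutationLaw σ → ∀ x, IsSwitchedTrajectory (polydisk n 1) F σ x →
      ‖x 0‖ < ρ → Tendsto x atTop (𝓝 0) := fun σ hσ x hx h0 =>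
    hx.tendsto_zero (isOpen_polydisk ρ) (fun i => (hF i).continuousOn.mono hsub) hV hσ
      ((closedBall_subset_ball h0).trans_eq hball.symm) fun a b ha hab =>
        hx.norm_le hF hφ hF0 hρ1 hinv hσ ha hab ((hnorm hσ hx h0 a ha).trans_lt h0)
  have hhalf : ρ / 2 < ρ := half_lt_self hρ0
  refine ⟨⟨fun η hη => ⟨min η (ρ / 2), by positivity, fun σ hσ x hx h0 t ht => ?_⟩,
    ρ / 2, half_pos hρ0, fun σ hσ x hx h0 => hlim σ hσ x hx (h0.trans_lt hhalf)⟩,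
    fun σ hσ x hx h0 => hlim σ hσ x hx (mem_ball_zero_iff.1 (hball ▸ h0))⟩
  exact (hnorm hσ hx ((h0.trans (min_le_right _ _)).trans_lt hhalf) t ht.le).trans
    (h0.trans (min_le_left _ _))

end SwitchedTrajectory

end SwitchedKoopman

theorem mainTheorem1 {n m : ℕ} [NeZero n]
    (F : Fin m → (Fin n → ℂ) → (Fin n → ℂ)) (φ : Fin m → ℝ → (Fin n → ℂ) → (Fin n → ℂ))
    (hF : ∀ i, DifferentiableOn ℂ (F i) (polydisk n 1))
    (hφ : ∀ i, IsForwardFlow (polydisk n 1) (F i) (φ i))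
    (heq : ∀ i, F i 0 = 0)
    (hhyp : ∀ i, ∀ μ ∈ spectrum ℂ (jacobian (F i) 0), μ.re < 0)
    (hgas : ∀ i, IsGASFlow (polydisk n 1) (φ i))
    (hsolv : GeneratesSolvable (fun i => jacobian (F i) 0))
    (ρ : ℝ) (hρ0 : 0 < ρ) (hρ1 : ρ ≤ 1)
    (hinv : ∀ i, ∀ t, 0 ≤ t → Set.MapsTo (φ i t) (polydisk n ρ) (polydisk n ρ)) :
    (∃ P : Matrix (Fin n) (Fin n) ℂ,
      IsNormalizedTriangularizer (fun i => jacobian (F i) 0) P) ∧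
    ∀ P : Matrix (Fin n) (Fin n) ℂ,
      IsNormalizedTriangularizer (fun i => jacobian (F i) 0) P →
    ∀ b : Fin m → ℕ → ℕ → ℝ,
      (∀ i j k, 1 ≤ j → 1 ≤ k → 0 ≤ b i j k) →
      (∀ i j k, 1 ≤ j → 1 ≤ k → koopmanEntry (conjField P (F i)) k j ≠ 0 →
        0 < b i j k * b i k j) →
      (∀ i j, 1 ≤ j →
        Summable (fun k : ℕ => b i j (k + 1)) ∧ ∑' k : ℕ, b i j (k + 1) ≤ 1) →
    ∀ ε : ℕ → ℝ,
      (∀ j, 1 ≤ j → 0 < ε j) →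
      (∀ i j k, 1 ≤ k → k < j → ε k * crossRatio (conjField P (F i)) (b i) j k < ε j) →
      Summable (fun k : ℕ => (degree (monomialEnum n (k + 1)) : ℝ) * ε (k + 1)
        * ρ ^ (2 * degree (monomialEnum n (k + 1)))) →
      IsGUAS (polydisk n 1) F (polydisk n ρ) ∧
      (∀ z ∈ polydisk n ρ, Summable (fun k : ℕ =>
        ε (k + 1) * ‖monomial (monomialEnum n (k + 1)) (P⁻¹ *ᵥ z)‖ ^ 2)) ∧
      IsCommonLyapunov F (polydisk n ρ) (fun z => ∑' k : ℕ,
        ε (k + 1) * ‖monomial (monomialEnum n (k + 1)) (P⁻¹ *ᵥ z)‖ ^ 2) := by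
  refine ⟨exists_isNormalizedTriangularizer hsolv, fun P hP b hb0 hb hbs ε hε hεQ hs => ?_⟩
  have hU : IsOpen (polydisk n 1) := isOpen_polydisk 1
  have h0 : 0 ∈ polydisk n 1 := zero_mem_polydisk one_pos
  have hball : polydisk n ρ = Metric.ball 0 ρ := polydisk_eq_ball hρ0
  have hε' : ∀ k, 0 < ε (k + 1) := fun k => hε _ (by omega)
  have hdom := fun i => isDominated_koopmanEntry_conjField hU h0 (hF i) (heq i) hP.1 (hP.2.2 i)
    (hhyp i) (hb0 i) (hb i) (hbs i) hε (hεQ i)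
  have hV := hball ▸ hP.isCommonLyapunov_lyapunovSeries hU (convex_polydisk 1) h0
    (hball ▸ polydisk_subset_polydisk hρ1) hF heq hε' hdom hs
  exact ⟨isGUAS_of_isCommonLyapunov hF hφ heq hρ0 hρ1 hinv hV, fun z hz =>
    summable_lyapunovSeries (fun k => (hε' k).le) (fun k => degree_monomialEnum_ne_zero (by omega))
      hs ((hP.norm_inv_mulVec_le z).trans (mem_ball_zero_iff.1 (hball ▸ hz)).le), hV⟩
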